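/- **Theorem.** Let $W=(W(t))_{t\in\mathbb R}$ be a standard two-sided Brownian motion on a probability space (that is, $(W(t))_{t\ge0}$ and $(W(-t))_{t\ge 0}$ are independent standard Brownian motions with almost surely continuous paths). For $T\in\mathbb R$ consider, for $t\ge -T$, the infinite linear system $$da_n(t)=\big[(n-1)a_{n-1}(t)-n\,a_{n+1}(t)\big]dt+\mathbf 1_{n=1}\,dW(t),\qquad n\ge 1,\qquad a_0\equiv 0,$$ with initial condition $a_n(-T)=\alpha_n$, where the real sequence $\alpha=(\alpha_n)_{n\ge1}$ does not depend on $T$. *Initial data.* $\alpha$ is called admissible if $G_0(z)=\sum_{n\ge0}\alpha_{n+1}z^n$ converges near $z=0$ and extends analytically to a neighbourhood of $(-1,0]$, the limit of $G_0(x)$ as $x\to-1^+$ along the real axis exists and is finite, and for some $\delta,\theta>0$ the function $G_0$ is analytic and bounded in the sector $\{z:0<|z+1|<\delta,\ |\arg(z+1)|<\theta\}$. *Solutions.* A solution is a family of functions $a_n(t)$, continuous in $t\ge -T$, that satisfies the system path by path in integrated form and has a generating function in the following sense: for every $t_1\ge -T$ there are $C,K$ with $|a_n(t)|\le CK^n$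 for all $n$ and all $t\in[-T,t_1]$ (so $\sum_{n\ge0} a_{n+1}(t)z^n$ converges on a disc around $0$ that is fixed on bounded time intervals). Then: 1. Almost surely, for every $T$ and every admissible $\alpha$, there is exactly one solution $a^{(T)}$ on $[-T,\infty)$ with $a^{(T)}_n(-T)=\alpha_n$ for all $n\ge 1$. 2. There are random variables $a_n^{**}(t)$, $n\ge1$, $t\in\mathbb R$, which are versions of the stochastic integrals $$a_n^{**}(t)=\int_{-\infty}^t\frac{\tanh^{n-1}(t-s)}{\cosh(t-s)}\,dW(s)$$ ($L^2$ limits of the elementary integrals of step functions converging in $L^2(\mathbb R)$ to the integrand), such that for every $n\ge 1$ and $t\in\mathbb R$, almost surely, for every admissible $\alpha$, $$\lim_{T\to\infty}a^{(T)}_n(t)=a_n^{**}(t).$$ 3. The process $(a_n^{**}(t))_{n\ge1,\,t\in\mathbb R}$ is jointly Gaussian with mean zero and stationary in time (for every $h$, the finite-dimensional distributions of $(a_n^{**}(t+h))_{n,t}$ and $(a_n^{**}(t))_{n,t}$ agree), and $$\mathbb E\,a_n^{**}(t)\,a_m^{**}(t)=\frac1{n+m-1}\qquad\text{for all } n,m\ge1,\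 t\in\mathbb R.$$ -/

import Mathlib

open MeasureTheory ProbabilityTheory Filter Topology
open scoped NNReal ENNReal

namespace ShellModel

/-- A standard two-sided Brownian motion: `(W t)` and `(W (-t))`, `t ≥ 0`, are two independent
standard Brownian motions (with almost surely continuous paths, started at `0`). -/
structure IsTwoSidedBrownian {Ω : Type*} [MeasurableSpace Ω] (W : ℝ → Ω → ℝ) (P : Measure Ω) :
    Prop where
  forward : IsBrownianReal (fun (t : ℝ≥0) ω => W (t : ℝ) ω) P
  backward : IsBrownianReal (fun (t : ℝ≥0) ω => W (-(t : ℝ)) ω) P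
  indep : IndepFun (fun ω (t : ℝ≥0) => W (t : ℝ) ω) (fun ω (t : ℝ≥0) => W (-(t : ℝ)) ω) P

/-- The data of a step function `∑ i, c i * 1_{(l i, r i]}` on the real line. -/
structure StepFunction where
  size : ℕ
  c : Fin size → ℝ
  l : Fin size → ℝ
  r : Fin size → ℝ
  l_le_r : ∀ i, l i ≤ r i

/-- The function `∑ i, c i * 1_{(l i, r i]}`. -/
noncomputable def StepFunction.toFun (g : StepFunction) (x : ℝ) : ℝ :=
  ∑ i, (Set.Ioc (g.l i) (g.r i)).indicator (fun _ => g.c i) x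

/-- The elementary stochastic integral `∑ i, c i * (W (r i) - W (l i))` of a step function. -/
noncomputable def StepFunction.integral {Ω : Type*} (g : StepFunction) (W : ℝ → Ω → ℝ) (ω : Ω) :
    ℝ :=
  ∑ i, g.c i * (W (g.r i) ω - W (g.l i) ω)

/-- `I` is (a version of) the stochastic integral `∫ f(s) dW(s)` over the real line of the
deterministic function `f ∈ L²(ℝ)`: the limit in `L²(P)` of the elementary integrals of
step functions that converge to `f` in `L²(ℝ)`. -/
def IsWienerIntegral {Ω : Type*} [MeasurableSpace Ω] (W : ℝ → Ω → ℝ) (P : Measure Ω)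
    (f : ℝ → ℝ) (I : Ω → ℝ) : Prop :=
  MemLp f 2 volume ∧ MemLp I 2 P ∧
    ∃ g : ℕ → StepFunction,
      Tendsto (fun k => eLpNorm (fun x => f x - (g k).toFun x) 2 volume) atTop (𝓝 0) ∧
      Tendsto (fun k => eLpNorm (fun ω => I ω - (g k).integral W ω) 2 P) atTop (𝓝 0)

/-- The function `s ↦ tanh^{n-1}(t-s) / cosh(t-s)` on `(-∞, t]`, extended by zero. -/
noncomputable def kernel (n : ℕ+) (t : ℝ) : ℝ → ℝ :=
  (Set.Iic t).indicator (fun s => Real.tanh (t - s) ^ ((n : ℕ) - 1) / Real.cosh (t - s))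

/-- The admissible initial sequences `α = (α₁, α₂, …)`. The function `G` is the generating function
`∑ α_{k+1} z^k` near `0`, continued analytically to a neighbourhood of `(-1, 0]`; it has a finite
limit at `-1` from the right along the real axis, and it is analytic and bounded in some
(arbitrarily thin and short) sector with vertex `-1` around the real axis. -/
def IsAdmissible (α : ℕ+ → ℝ) : Prop :=
  ∃ G : ℂ → ℂ,
    (∀ᶠ z in 𝓝 (0 : ℂ), HasSum (fun k : ℕ => (α k.succPNat : ℂ) * z ^ k) (G z)) ∧
    (∀ x ∈ Set.Ioc (-1 : ℝ) 0, AnalyticAt ℂ G (x : ℂ)) ∧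
    (∃ L : ℂ, Tendsto (fun x : ℝ => G (x : ℂ)) (𝓝[>] (-1 : ℝ)) (𝓝 L)) ∧
    ∃ δ > (0 : ℝ), ∃ θ > (0 : ℝ), ∃ M : ℝ,
      ∀ z : ℂ, 0 < ‖z + 1‖ → ‖z + 1‖ < δ → |Complex.arg (z + 1)| < θ →
        AnalyticAt ℂ G z ∧ ‖G z‖ ≤ M

/-- `a` solves, on `[t₀, ∞)` and with `a_n(t₀) = α_n`, the system
`da_n = ((n-1) a_{n-1} - n a_{n+1}) dt + 1_{n=1} dw`, `n ≥ 1`, with `a_0 = 0`, driven by the path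
`w`. The noise is additive, so that the equation makes sense, path by path, in integrated form.
The field `growth` says that the generating function `∑ a_{k+1}(t) z^k` of the solution exists,
that is, converges on a disc around `0` that does not shrink on bounded time intervals. -/
structure IsForcedSolution (w : ℝ → ℝ) (t₀ : ℝ) (α : ℕ+ → ℝ) (a : ℕ → ℝ → ℝ) : Prop where
  boundary : ∀ t, t₀ ≤ t → a 0 t = 0
  initial : ∀ n : ℕ+, a n t₀ = α n
  continuous : ∀ n, ContinuousOn (a n) (Set.Ici t₀)
  equation : ∀ n : ℕ, 1 ≤ n → ∀ t, t₀ ≤ t →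
    a n t = a n t₀ + (∫ s in t₀..t, (((n : ℝ) - 1) * a (n - 1) s - (n : ℝ) * a (n + 1) s))
      + (if n = 1 then w t - w t₀ else 0)
  growth : ∀ t₁, t₀ ≤ t₁ → ∃ C K : ℝ, ∀ n, ∀ t ∈ Set.Icc t₀ t₁, |a n t| ≤ C * K ^ n

end ShellModel

/-! By linearity a solution is the noiseless flow of the datum plus the response to the noise. For
G(τ,z) = ∑ a_{n+1}(τ) zⁿ the noiseless system is the transport equation ∂_τ G = z G + (z² - 1) ∂_z
G, and its characteristics give a_1(τ) = G_0(-tanh τ) / cosh τ (`firstMode`). The system, solved for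
a_{n+1} in terms of a_{n-1} and a_n', then yields every component from derivatives of the first
(`tower`). Only values of G_0 near (-1, 0] enter, which is the region that admissibility controls.

Differentiating in time amounts to applying the generator `genOp` to G_0 (`hasDerivAt_firstMode`).
The generator preserves boundedness on a cone at -1, because z² - 1 vanishes there and pays for the
Cauchy estimate of ∂_z G (`IsConeBounded.genOp`). Hence each derivative of a_1 is O(1 / cosh τ), and
every component of the flow tends to zero: the datum is forgotten. On bounded time intervals Cauchy
estimates bound the k-th derivative by C Rᵏ k!, which gives geometric growth in n (`abs_tower_le`).
Geometric growth also forces uniqueness: iterating the integral equation k times bounds the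
difference of two solutions by a k-th power that is small on short intervals.

The response to the noise is the convolution of dW with the noiseless solution tanh^{n-1} / cosh
started from (1, 0, 0, …). Integrated by parts it makes sense path by path (`forced`). Brownian
paths grow at most linearly and the kernels decay exponentially, so it converges as the starting
time tends to -∞ (`tendsto_forced`). The same limit is reached by elementary integrals of step
functions that converge to the kernel in L² (`tendsto_riemannSum`), so it is a version of the
stochastic integral (`IsWienerIntegral.of_ae_tendsto`).

The remaining claims follow from the isometry. Linear combinations of Wiener integrals are Wiener
integrals, hence centred Gaussian with variance the squared L² norm. Moving time translates the
kernels and keeps these norms, which gives stationarity. The covariance is the integral of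
tanh^{n+m-2} / cosh² over the half-line. -/

namespace ShellModel

/-! ### Pathwise uniqueness -/

/-- A bounded-growth solution of the homogeneous integrated system with zero initial data is small
of every order in time. -/
lemma abs_le_of_homogeneous {d : ℕ → ℝ → ℝ} {t₀ t₁ C K : ℝ} (hK : 1 ≤ K) (hC : 0 ≤ C)
    (hbd : ∀ n, ∀ t ∈ Set.Icc t₀ t₁, |d n t| ≤ C * K ^ n)
    (h0 : ∀ t ∈ Set.Icc t₀ t₁, d 0 t = 0)
    (heq : ∀ n : ℕ, 1 ≤ n → ∀ t ∈ Set.Icc t₀ t₁,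
      d n t = ∫ s in t₀..t, (((n : ℝ) - 1) * d (n - 1) s - (n : ℝ) * d (n + 1) s)) (k : ℕ) :
    ∀ n, ∀ t ∈ Set.Icc t₀ t₁,
      |d n t| ≤ C * K ^ (n + k) * 2 ^ k * (n + k).choose k * (t - t₀) ^ k := by
  induction k with
  | zero => simpa using hbd
  | succ k ih =>
    intro n t ht
    rcases n with _ | n
    · rw [h0 t ht, abs_zero]
      have := sub_nonneg.2 ht.1
      positivity
    rw [heq (n + 1) (by omega) t ht]
    have key : ∀ s ∈ Set.Ioc t₀ t, ‖(((n + 1 : ℕ) : ℝ) - 1) * d (n + 1 - 1) s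
        - ((n + 1 : ℕ) : ℝ) * d (n + 1 + 1) s‖ ≤
        C * K ^ (n + 1 + (k + 1)) * 2 ^ (k + 1) * ((k + 1) * (n + 1 + (k + 1)).choose (k + 1))
          * (s - t₀) ^ k := by
      intro s hs
      have hs' : s ∈ Set.Icc t₀ t₁ := ⟨hs.1.le, hs.2.trans ht.2⟩
      have h1 := ih n s hs'
      have h2 := ih (n + 2) s hs'
      have hnn : 0 ≤ (s - t₀) ^ k := pow_nonneg (sub_nonneg.2 hs.1.le) k
      -- The factor k + 1 is kept so that it cancels against the integral of (s - t₀)ᵏ. The two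
      -- coefficients n and n + 1 add up to at most 2 (n + 2), which supplies the new factor 2.
      have e1 : ((k : ℝ) + 1) * (n + 1 + (k + 1)).choose (k + 1)
          = (n + 2) * (n + 2 + k).choose k := by
        have := Nat.choose_succ_right_eq (n + 2 + k) k
        have h3 : n + 2 + k - k = n + 2 := by omega
        rw [h3] at this
        have h4 : n + 1 + (k + 1) = n + 2 + k := by omega
        rw [h4]
        have : (((n + 2 + k).choose (k + 1) * (k + 1) : ℕ) : ℝ)
          = (((n + 2 + k).choose k * (n + 2) : ℕ) : ℝ) := by rw [this]
        push_cast at this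
        linarith
      have e2 : ((n + k).choose k : ℝ) ≤ (n + 2 + k).choose k := by
        exact_mod_cast Nat.choose_le_choose k (by omega)
      have e3 : K ^ (n + k) ≤ K ^ (n + 1 + (k + 1)) := pow_le_pow_right₀ hK (by omega)
      have e4 : n + 2 + k = n + 1 + (k + 1) := by omega
      rw [e1]
      rw [e4] at h2 e2 ⊢
      set c : ℝ := ((n + 1 + (k + 1)).choose k : ℝ)
      set q := (s - t₀) ^ k
      set Q := K ^ (n + 1 + (k + 1))
      have hB : C * K ^ (n + k) * 2 ^ k * (n + k).choose k * q ≤ C * Q * 2 ^ k * c * q := by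
        gcongr
      have hpos : 0 ≤ C * Q * 2 ^ k * c * q := by positivity
      rw [Real.norm_eq_abs]
      push_cast
      have hn : (0 : ℝ) ≤ n := Nat.cast_nonneg n
      calc |((n : ℝ) + 1 - 1) * d n s - ((n : ℝ) + 1) * d (n + 1 + 1) s|
          ≤ |((n : ℝ) + 1 - 1) * d n s| + |((n : ℝ) + 1) * d (n + 1 + 1) s| := abs_sub _ _
        _ = n * |d n s| + (n + 1) * |d (n + 2) s| := by
            rw [abs_mul, abs_mul, add_sub_cancel_right, abs_of_nonneg hn,
              abs_of_nonneg (by positivity : (0 : ℝ) ≤ n + 1)]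
        _ ≤ n * (C * Q * 2 ^ k * c * q) + (n + 1) * (C * Q * 2 ^ k * c * q) := by
            gcongr
            exact h1.trans hB
        _ ≤ C * Q * 2 ^ (k + 1) * ((n + 2) * c) * q := by
            rw [pow_succ]; nlinarith
    have hint : IntervalIntegrable (fun s => C * K ^ (n + 1 + (k + 1)) * 2 ^ (k + 1) *
        ((k + 1) * (n + 1 + (k + 1)).choose (k + 1)) * (s - t₀) ^ k) volume t₀ t :=
      (by fun_prop : Continuous _).intervalIntegrable _ _
    have := intervalIntegral.norm_integral_le_of_norm_le ht.1 (ae_of_all _ key) hint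
    refine this.trans_eq ?_
    rw [intervalIntegral.integral_const_mul]
    have hi : ∫ x in t₀..t, (x - t₀) ^ k = (t - t₀) ^ (k + 1) / (k + 1) := by
      rw [intervalIntegral.integral_comp_sub_right (fun x => x ^ k)]
      simp
    rw [hi]
    field_simp

/-- Since binom(n+k, k) ≤ 2^{n+k}, the order-k bound is at most C (2K)ⁿ (4K(t - t₀))ᵏ. The length
restriction makes the last base at most 1/2, and k → ∞ finishes. -/
lemma eq_zero_of_homogeneous_short {d : ℕ → ℝ → ℝ} {t₀ t₁ C K : ℝ} (hK : 1 ≤ K) (hC : 0 ≤ C)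
    (ht₁ : 8 * K * (t₁ - t₀) ≤ 1)
    (hbd : ∀ n, ∀ t ∈ Set.Icc t₀ t₁, |d n t| ≤ C * K ^ n)
    (h0 : ∀ t ∈ Set.Icc t₀ t₁, d 0 t = 0)
    (heq : ∀ n : ℕ, 1 ≤ n → ∀ t ∈ Set.Icc t₀ t₁,
      d n t = ∫ s in t₀..t, (((n : ℝ) - 1) * d (n - 1) s - (n : ℝ) * d (n + 1) s)) :
    ∀ n, ∀ t ∈ Set.Icc t₀ t₁, d n t = 0 := by
  intro n t ht
  have hle : ∀ k : ℕ, |d n t| ≤ C * K ^ n * 2 ^ n * (1 / 2) ^ k := by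
    intro k
    refine (abs_le_of_homogeneous hK hC hbd h0 heq k n t ht).trans ?_
    have h1 : ((n + k).choose k : ℝ) ≤ 2 ^ (n + k) := by
      exact_mod_cast Nat.choose_le_two_pow (n + k) k
    have hs := sub_nonneg.2 ht.1
    have h2 : 4 * K * (t - t₀) ≤ 1 / 2 := by
      have : K * (t - t₀) ≤ K * (t₁ - t₀) := by
        have := ht.2
        gcongr
      linarith
    calc C * K ^ (n + k) * 2 ^ k * (n + k).choose k * (t - t₀) ^ k
        ≤ C * K ^ (n + k) * 2 ^ k * 2 ^ (n + k) * (t - t₀) ^ k := by gcongr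
      _ = C * K ^ n * 2 ^ n * (4 * K * (t - t₀)) ^ k := by
          rw [pow_add, pow_add, mul_pow, mul_pow, show (4 : ℝ) = 2 * 2 by norm_num, mul_pow]; ring
      _ ≤ C * K ^ n * 2 ^ n * (1 / 2) ^ k := by gcongr
  have hlim : Tendsto (fun k : ℕ => C * K ^ n * 2 ^ n * (1 / 2 : ℝ) ^ k) atTop (𝓝 0) := by
    simpa using (tendsto_pow_atTop_nhds_zero_of_lt_one (by norm_num : (0 : ℝ) ≤ 1 / 2)
      (by norm_num)).const_mul (C * K ^ n * 2 ^ n)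
  exact abs_nonpos_iff.1 (ge_of_tendsto' hlim hle)

/-- The admissible length 1/(8K) depends only on K, which serves the whole interval, so finitely
many restarts reach any time. -/
lemma eq_zero_of_homogeneous {d : ℕ → ℝ → ℝ} {t₀ t₁ C K : ℝ} (hK : 1 ≤ K) (hC : 0 ≤ C)
    (hcont : ∀ n, ContinuousOn (d n) (Set.Icc t₀ t₁))
    (hbd : ∀ n, ∀ t ∈ Set.Icc t₀ t₁, |d n t| ≤ C * K ^ n)
    (h0 : ∀ t ∈ Set.Icc t₀ t₁, d 0 t = 0)
    (heq : ∀ n : ℕ, 1 ≤ n → ∀ t ∈ Set.Icc t₀ t₁,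
      d n t = ∫ s in t₀..t, (((n : ℝ) - 1) * d (n - 1) s - (n : ℝ) * d (n + 1) s)) :
    ∀ n, ∀ t ∈ Set.Icc t₀ t₁, d n t = 0 := by
  have hK0 : 0 < K := by linarith
  have step : ∀ j : ℕ, ∀ n, ∀ t ∈ Set.Icc t₀ t₁, t ≤ t₀ + j * (1 / (8 * K)) → d n t = 0 := by
    intro j
    induction j with
    | zero =>
      intro n t ht hj
      have : t = t₀ := le_antisymm (by simpa using hj) ht.1
      subst this
      rcases n with _ | n
      · exact h0 _ ht
      · rw [heq _ (by omega) _ ht, intervalIntegral.integral_same]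
    | succ j ih =>
      intro n t ht hj
      by_cases hcase : t ≤ t₀ + j * (1 / (8 * K))
      · exact ih n t ht hcase
      push Not at hcase
      set s₀ := t₀ + j * (1 / (8 * K)) with hs₀
      have hs₀0 : t₀ ≤ s₀ := by rw [hs₀]; have : 0 ≤ (j : ℝ) * (1 / (8 * K)) := by positivity
                                linarith
      have hsub : Set.Icc s₀ t ⊆ Set.Icc t₀ t₁ := Set.Icc_subset_Icc hs₀0 ht.2
      have hs₀m : s₀ ∈ Set.Icc t₀ t₁ := hsub ⟨le_rfl, hcase.le⟩
      refine eq_zero_of_homogeneous_short (t₀ := s₀) (t₁ := t) hK hC ?_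
        (fun n x hx => hbd n x (hsub hx))
        (fun x hx => h0 x (hsub hx)) ?_ n t ⟨hcase.le, le_rfl⟩
      · have : t - s₀ ≤ 1 / (8 * K) := by
          push_cast at hj
          rw [hs₀]; linarith
        calc 8 * K * (t - s₀) ≤ 8 * K * (1 / (8 * K)) := by gcongr
          _ = 1 := by field_simp
      · intro m hm x hx
        have hxm := hsub hx
        have hII : ∀ a ∈ Set.Icc t₀ t₁, ∀ b ∈ Set.Icc t₀ t₁, IntervalIntegrable
            (fun s => ((m : ℝ) - 1) * d (m - 1) s - (m : ℝ) * d (m + 1) s) volume a b := by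
          intro a ha b hb
          refine ContinuousOn.intervalIntegrable ?_
          have hs : Set.uIcc a b ⊆ Set.Icc t₀ t₁ := Set.uIcc_subset_Icc ha hb
          exact ((hcont _).mono hs |>.const_smul ((m : ℝ) - 1)).sub
            ((hcont _).mono hs |>.const_smul (m : ℝ))
        have ht₀ : t₀ ∈ Set.Icc t₀ t₁ := ⟨le_rfl, ht.1.trans ht.2⟩
        have e := intervalIntegral.integral_add_adjacent_intervals
          (hII t₀ ht₀ s₀ hs₀m) (hII s₀ hs₀m x hxm)
        rw [← heq m hm x hxm, ← heq m hm s₀ hs₀m, ih m s₀ hs₀m le_rfl, zero_add] at e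
        exact e.symm
  intro n t ht
  obtain ⟨j, hj⟩ := exists_nat_ge ((t - t₀) / (1 / (8 * K)))
  refine step j n t ht ?_
  rw [div_le_iff₀ (by positivity)] at hj
  linarith

/-- Path by path, there is at most one solution. -/
lemma IsForcedSolution.unique {w : ℝ → ℝ} {t₀ : ℝ} {α : ℕ+ → ℝ} {a b : ℕ → ℝ → ℝ}
    (ha : IsForcedSolution w t₀ α a) (hb : IsForcedSolution w t₀ α b) (n : ℕ) {t : ℝ}
    (ht : t₀ ≤ t) : b n t = a n t := by
  obtain ⟨C, K, hCK⟩ := ha.growth t ht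
  obtain ⟨C', K', hCK'⟩ := hb.growth t ht
  -- The growth constants carry no sign condition; this is a common base that is at least 1.
  set L := |K| + |K'| + 1 with hL
  have hL1 : 1 ≤ L := by have := abs_nonneg K; have := abs_nonneg K'; linarith
  have hb1 : ∀ n : ℕ, C * K ^ n ≤ |C| * L ^ n := fun n => by
    calc C * K ^ n ≤ |C * K ^ n| := le_abs_self _
      _ = |C| * |K| ^ n := by rw [abs_mul, abs_pow]
      _ ≤ |C| * L ^ n := by gcongr; have := abs_nonneg K'; linarith
  have hb2 : ∀ n : ℕ, C' * K' ^ n ≤ |C'| * L ^ n := fun n => by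
    calc C' * K' ^ n ≤ |C' * K' ^ n| := le_abs_self _
      _ = |C'| * |K'| ^ n := by rw [abs_mul, abs_pow]
      _ ≤ |C'| * L ^ n := by gcongr; have := abs_nonneg K; linarith
  have hsub : Set.Icc t₀ t ⊆ Set.Ici t₀ := fun x hx => hx.1
  have hinit : ∀ n : ℕ, 1 ≤ n → a n t₀ = b n t₀ := fun n hn => by
    exact (ha.initial ⟨n, hn⟩).trans (hb.initial ⟨n, hn⟩).symm
  have := eq_zero_of_homogeneous (d := fun n t => b n t - a n t) (t₀ := t₀) (t₁ := t)
    (C := |C| + |C'|) (K := L) hL1 (by positivity)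
    (fun n => ((hb.continuous n).sub (ha.continuous n)).mono hsub)
    (fun n x hx => by
      calc |b n x - a n x| ≤ |b n x| + |a n x| := abs_sub _ _
        _ ≤ |C'| * L ^ n + |C| * L ^ n :=
          add_le_add ((hCK' n x hx).trans (hb2 n)) ((hCK n x hx).trans (hb1 n))
        _ = (|C| + |C'|) * L ^ n := by ring)
    (fun x hx => by simp [ha.boundary x hx.1, hb.boundary x hx.1])
    (fun m hm x hx => by
      have hII : ∀ {c : ℕ → ℝ → ℝ}, IsForcedSolution w t₀ α c → IntervalIntegrable
          (fun s => ((m : ℝ) - 1) * c (m - 1) s - (m : ℝ) * c (m + 1) s) volume t₀ x := by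
        intro c hc
        refine ContinuousOn.intervalIntegrable ?_
        have hs : Set.uIcc t₀ x ⊆ Set.Ici t₀ := by
          rw [Set.uIcc_of_le hx.1]; exact fun y hy => hy.1
        exact ((hc.continuous _).mono hs |>.const_smul ((m : ℝ) - 1)).sub
          ((hc.continuous _).mono hs |>.const_smul (m : ℝ))
      rw [hb.equation m hm x hx.1, ha.equation m hm x hx.1, hinit m hm]
      rw [show (fun s => ((m : ℝ) - 1) * (b (m - 1) s - a (m - 1) s)
        - (m : ℝ) * (b (m + 1) s - a (m + 1) s)) = fun s =>
        (((m : ℝ) - 1) * b (m - 1) s - (m : ℝ) * b (m + 1) s) -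
        (((m : ℝ) - 1) * a (m - 1) s - (m : ℝ) * a (m + 1) s) from by ext; ring,
        intervalIntegral.integral_sub (hII hb) (hII ha)]
      ring)
    n t ⟨ht, le_rfl⟩
  exact sub_eq_zero.1 this

/-! ### Recovering all components from the first -/

/-- The matrix of the system acting on the coefficients of a power series. -/
def shiftOp (c : ℕ → ℝ) (m : ℕ) : ℝ := m * c (m - 1) - (m + 1) * c (m + 1)

/-- The solution of the homogeneous system whose first component has the derivatives `φ k`;
`tower φ n k` is the `k`-th derivative of its `n`-th component. -/
noncomputable def tower (φ : ℕ → ℝ → ℝ) : ℕ → ℕ → ℝ → ℝ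
  | 0, _ => 0
  | 1, k => φ k
  | n + 2, k => fun τ => (n * tower φ n k τ - tower φ (n + 1) (k + 1) τ) / (n + 1)

lemma hasDerivAt_tower {φ : ℕ → ℝ → ℝ} {τ : ℝ}
    (hφ : ∀ k, HasDerivAt (φ k) (φ (k + 1) τ) τ) :
    ∀ n k, HasDerivAt (tower φ n k) (tower φ n (k + 1) τ) τ
  | 0, _ => hasDerivAt_const τ 0
  | 1, k => hφ k
  | n + 2, k => by
    simp only [tower]
    exact (((hasDerivAt_tower hφ n k).const_mul _).sub
      (hasDerivAt_tower hφ (n + 1) (k + 1))).div_const _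

lemma tower_succ_right (φ : ℕ → ℝ → ℝ) (n k : ℕ) (τ : ℝ) (hn : 1 ≤ n) :
    tower φ n (k + 1) τ = ((n : ℝ) - 1) * tower φ (n - 1) k τ - n * tower φ (n + 1) k τ := by
  obtain ⟨n, rfl⟩ : ∃ m, n = m + 1 := ⟨n - 1, by omega⟩
  simp only [tower, Nat.add_sub_cancel]
  push_cast
  field_simp
  ring

/-- Each component is a fixed linear combination of finitely many derivatives of the first, so decay
of those derivatives is all that is needed. -/
lemma tendsto_tower {φ : ℕ → ℝ → ℝ} {l : Filter ℝ} (hφ : ∀ k, Tendsto (φ k) l (𝓝 0)) :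
    ∀ n k, Tendsto (tower φ n k) l (𝓝 0)
  | 0, _ => tendsto_const_nhds
  | 1, k => hφ k
  | n + 2, k => by
    simp only [tower]
    simpa using (((tendsto_tower hφ n k).const_mul (n : ℝ)).sub
      (tendsto_tower hφ (n + 1) (k + 1))).div_const _

/-- At time zero the recursion defining `tower` is the relation between successive iterates of
`shiftOp`, solved for the highest index. Prescribing all derivatives of the first component
therefore prescribes the whole datum. -/
lemma tower_zero_eq_iterate {φ : ℕ → ℝ → ℝ} {c : ℕ → ℝ}
    (hφ : ∀ k, φ k 0 = (shiftOp^[k] c) 0) : ∀ m k, tower φ (m + 1) k 0 = (shiftOp^[k] c) m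
  | 0, k => hφ k
  | 1, k => by
    have h := tower_zero_eq_iterate hφ 0 (k + 1)
    simp only [tower] at h ⊢
    rw [h, Function.iterate_succ_apply', shiftOp]
    simp
  | m + 2, k => by
    have h := tower_zero_eq_iterate hφ (m + 1) (k + 1)
    have h' := tower_zero_eq_iterate hφ m k
    rw [Function.iterate_succ_apply', shiftOp] at h
    change ((m + 1 : ℕ) * tower φ (m + 1) k 0 - tower φ (m + 1 + 1) (k + 1) 0) /
      ((m + 1 : ℕ) + 1 : ℝ) = _
    rw [h, h', Nat.add_sub_cancel]
    push_cast
    field_simp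
    ring

/-- Each step up in n costs one more derivative, so the induction must carry all k; the quotient
(n+k)!/n! absorbs this cost and equals 1 at k = 0, leaving geometric growth. The constant 4 works
because 1 + 8R² ≤ 16R². -/
lemma abs_tower_le {φ : ℕ → ℝ → ℝ} {C R τ : ℝ} (hR : 1 ≤ R)
    (hφ : ∀ k, |φ k τ| ≤ C * R ^ k * k.factorial) :
    ∀ n k, |tower φ n k τ| ≤ C * (4 * R) ^ n * R ^ k * ((n + k).factorial / n.factorial)
  | 0, k => by
    have hC : 0 ≤ C := by simpa using (abs_nonneg _).trans (hφ 0)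
    simp only [tower, Pi.zero_apply, abs_zero]
    positivity
  | 1, k => by
    have hC : 0 ≤ C := by simpa using (abs_nonneg _).trans (hφ 0)
    refine (hφ k).trans ?_
    have h1 : (k.factorial : ℝ) ≤ (1 + k).factorial := by
      exact_mod_cast Nat.factorial_le (by omega)
    simp only [pow_one, Nat.factorial_one, Nat.cast_one, div_one]
    calc C * R ^ k * k.factorial ≤ C * R ^ k * (1 + k).factorial := by gcongr
      _ = C * 1 * R ^ k * (1 + k).factorial := by ring
      _ ≤ C * (4 * R) * R ^ k * (1 + k).factorial := by gcongr; linarith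
  | n + 2, k => by
    have hC : 0 ≤ C := by simpa using (abs_nonneg _).trans (hφ 0)
    have h1 := abs_tower_le hR hφ n k
    have h2 := abs_tower_le hR hφ (n + 1) (k + 1)
    have f1 : ((n + 2).factorial : ℝ) = (n + 2) * ((n + 1) * n.factorial) := by
      push_cast [Nat.factorial_succ]; ring
    have f1' : ((n + 1).factorial : ℝ) = (n + 1) * n.factorial := by
      push_cast [Nat.factorial_succ]; ring
    have f2 : ((n + 2 + k).factorial : ℝ) = (n + k + 2) * ((n + k + 1) * (n + k).factorial) := by
      rw [show n + 2 + k = n + k + 1 + 1 by omega]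
      push_cast [Nat.factorial_succ]; ring
    have f2' : ((n + 1 + (k + 1)).factorial : ℝ) = (n + 2 + k).factorial := by
      rw [show n + 2 + k = n + 1 + (k + 1) by omega]
    have hn : (0 : ℝ) ≤ n := Nat.cast_nonneg n
    have hk : (0 : ℝ) ≤ k := Nat.cast_nonneg k
    have hf : (0 : ℝ) < n.factorial := by positivity
    have hg : (0 : ℝ) < (n + k).factorial := by positivity
    set X : ℝ := ((n + 2 + k).factorial / (n + 2).factorial : ℝ) with hX
    have hX0 : 0 ≤ X := by positivity
    have k1 : (n : ℝ) * ((n + k).factorial / n.factorial) ≤ (n + 1) * X := by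
      rw [hX, f1, f2, ← mul_div_assoc, ← mul_div_assoc, div_le_div_iff₀ hf (by positivity)]
      have : (n : ℝ) * (n + 2) ≤ (n + k + 2) * (n + k + 1) := by nlinarith [mul_nonneg hn hk]
      nlinarith [mul_le_mul_of_nonneg_left this (by positivity :
        0 ≤ ((n + 1) * (n.factorial : ℝ) * (n + k).factorial))]
    have k2 : ((n + 1 + (k + 1)).factorial / (n + 1).factorial : ℝ) ≤ (n + 1) * (2 * X) := by
      rw [f2', hX, f1, f1', ← mul_div_assoc, ← mul_div_assoc, div_le_div_iff₀ (by positivity)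
        (by positivity)]
      have hp : 0 ≤ ((n + 1) * (n.factorial : ℝ) * (n + 2 + k).factorial) := by positivity
      nlinarith
    simp only [tower]
    rw [abs_div, abs_of_nonneg (by positivity : (0 : ℝ) ≤ n + 1), div_le_iff₀ (by positivity)]
    have hRk : 0 ≤ R ^ k := by positivity
    calc |n * tower φ n k τ - tower φ (n + 1) (k + 1) τ|
        ≤ |n * tower φ n k τ| + |tower φ (n + 1) (k + 1) τ| := abs_sub _ _
      _ = n * |tower φ n k τ| + |tower φ (n + 1) (k + 1) τ| := by
          rw [abs_mul, abs_of_nonneg hn]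
      _ ≤ n * (C * (4 * R) ^ n * R ^ k * ((n + k).factorial / n.factorial)) +
          C * (4 * R) ^ (n + 1) * R ^ (k + 1) *
            ((n + 1 + (k + 1)).factorial / (n + 1).factorial) := by gcongr
      _ = C * (4 * R) ^ n * R ^ k * (n * ((n + k).factorial / n.factorial)) +
          C * (4 * R) ^ (n + 1) * R ^ (k + 1) *
            ((n + 1 + (k + 1)).factorial / (n + 1).factorial) := by ring
      _ ≤ C * (4 * R) ^ n * R ^ k * ((n + 1) * X) +
          C * (4 * R) ^ (n + 1) * R ^ (k + 1) * ((n + 1) * (2 * X)) := by gcongr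
      _ = C * (4 * R) ^ n * R ^ k * ((n + 1) * X) * (1 + 8 * R ^ 2) := by ring
      _ ≤ C * (4 * R) ^ n * R ^ k * ((n + 1) * X) * (16 * R ^ 2) := by
          gcongr
          nlinarith
      _ = C * (4 * R) ^ (n + 2) * R ^ k * X * (n + 1) := by ring

/-! ### Green's function and the response to the noise -/

/-- The Green's function `tanh^m / cosh` of the system. -/
noncomputable def green (m : ℕ) (u : ℝ) : ℝ := Real.tanh u ^ m / Real.cosh u

/-- The derivative of `green m`. -/
noncomputable def greenDeriv (m : ℕ) (u : ℝ) : ℝ :=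
  m * green (m - 1) u - (m + 1) * green (m + 1) u

lemma hasDerivAt_real_tanh (u : ℝ) : HasDerivAt Real.tanh (1 - Real.tanh u ^ 2) u := by
  have h := (Real.hasDerivAt_sinh u).div (Real.hasDerivAt_cosh u) (Real.cosh_pos u).ne'
  have e : Real.tanh = Real.sinh / Real.cosh := by
    ext x; exact Real.tanh_eq_sinh_div_cosh x
  rw [e]
  refine h.congr_deriv ?_
  have := (Real.cosh_pos u).ne'
  rw [Pi.div_apply]
  field_simp

/-- From tanh' = 1 - tanh² and (1/cosh)' = -tanh/cosh: the functions `green` solve the noiseless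
system, and by `green_zero` they start from (1, 0, 0, …). -/
lemma hasDerivAt_green (m : ℕ) (u : ℝ) : HasDerivAt (green m) (greenDeriv m u) u := by
  have hc := (Real.cosh_pos u).ne'
  have h := ((hasDerivAt_real_tanh u).pow m).div (Real.hasDerivAt_cosh u) hc
  refine HasDerivAt.congr_deriv (f := green m) h ?_
  have e : Real.sinh u = Real.tanh u * Real.cosh u := by
    rw [Real.tanh_eq_sinh_div_cosh]; field_simp
  simp only [greenDeriv, green, e, Pi.pow_apply]
  rcases m with _ | m
  · simp; field_simp
  · simp only [Nat.add_sub_cancel]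
    push_cast
    field_simp
    ring

lemma continuous_green (m : ℕ) : Continuous (green m) :=
  continuous_iff_continuousAt.2 fun u => (hasDerivAt_green m u).continuousAt

lemma continuous_greenDeriv (m : ℕ) : Continuous (greenDeriv m) :=
  ((continuous_green _).const_smul (m : ℝ)).sub ((continuous_green _).const_smul ((m : ℝ) + 1))

lemma green_zero (m : ℕ) : green m 0 = if m = 0 then 1 else 0 := by
  rcases m with _ | m <;> simp [green]

lemma abs_green_le (m : ℕ) (u : ℝ) : |green m u| ≤ 2 * Real.exp (-|u|) := by
  rw [green, abs_div, abs_pow, abs_of_pos (Real.cosh_pos u)]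
  have h1 : |Real.tanh u| ^ m ≤ 1 := pow_le_one₀ (abs_nonneg _) (Real.abs_tanh_lt_one u).le
  have h2 : Real.exp |u| / 2 ≤ Real.cosh u := by
    rw [← Real.cosh_abs, Real.cosh_eq]
    have := Real.exp_pos (-|u|)
    linarith
  calc |Real.tanh u| ^ m / Real.cosh u ≤ 1 / (Real.exp |u| / 2) := by
        gcongr
    _ = 2 * Real.exp (-|u|) := by rw [Real.exp_neg]; field_simp

lemma abs_greenDeriv_le (m : ℕ) (u : ℝ) :
    |greenDeriv m u| ≤ (4 * m + 2) * Real.exp (-|u|) := by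
  have h1 := abs_green_le (m - 1) u
  have h2 := abs_green_le (m + 1) u
  calc |greenDeriv m u| ≤ |m * green (m - 1) u| + |(m + 1) * green (m + 1) u| := abs_sub _ _
    _ = m * |green (m - 1) u| + (m + 1) * |green (m + 1) u| := by
        rw [abs_mul, abs_mul, abs_of_nonneg (Nat.cast_nonneg m),
          abs_of_nonneg (by positivity : (0 : ℝ) ≤ (m : ℝ) + 1)]
    _ ≤ m * (2 * Real.exp (-|u|)) + (m + 1) * (2 * Real.exp (-|u|)) := by gcongr
    _ = (4 * m + 2) * Real.exp (-|u|) := by ring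

/-- Leibniz rule for a convolution on an interval. -/
lemma hasDerivAt_integral_convolution {h h' v : ℝ → ℝ} (hh : ∀ x, HasDerivAt h (h' x) x)
    (hh' : Continuous h') (hv : Continuous v) (t₀ t : ℝ) :
    HasDerivAt (fun t => ∫ s in t₀..t, h (t - s) * v s)
      (h 0 * v t + ∫ s in t₀..t, h' (t - s) * v s) t := by
  have hc : Continuous h := continuous_iff_continuousAt.2 fun u => (hh u).continuousAt
  -- The two roles of t, endpoint and parameter of the kernel, are separated; joint
  -- differentiability is then restricted to the diagonal.
  let f : ℝ → ℝ → ℝ := fun x y => ∫ s in t₀..x, h (y - s) * v s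
  have hint : ∀ x y, HasDerivAt (fun x => f x y) (h (y - x) * v x) x := fun x y =>
    intervalIntegral.integral_hasDerivAt_right
      ((by fun_prop : Continuous fun s => h (y - s) * v s).intervalIntegrable _ _)
      ((by fun_prop : Continuous fun s => h (y - s) * v s).stronglyMeasurableAtFilter _ _)
      (by fun_prop : Continuous fun s => h (y - s) * v s).continuousAt
  have hpar : ∀ x y, HasDerivAt (f x) (∫ s in t₀..x, h' (y - s) * v s) y := by
    intro x y
    have hcompact : IsCompact (Metric.closedBall y 1 ×ˢ Set.uIcc t₀ x) :=
      (isCompact_closedBall y 1).prod isCompact_uIcc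
    obtain ⟨B, hB⟩ := hcompact.exists_bound_of_continuousOn
      (f := fun p : ℝ × ℝ => h' (p.1 - p.2) * v p.2) (by fun_prop)
    refine (intervalIntegral.hasDerivAt_integral_of_dominated_loc_of_deriv_le
      (F := fun y s => h (y - s) * v s) (F' := fun y s => h' (y - s) * v s) (bound := fun _ => B)
      (Metric.closedBall_mem_nhds y one_pos) ?_ ?_ ?_ ?_ ?_ ?_).2
    · exact Eventually.of_forall fun z =>
        (by fun_prop : Continuous fun s => h (z - s) * v s).aestronglyMeasurable
    · exact (by fun_prop : Continuous fun s => h (y - s) * v s).intervalIntegrable _ _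
    · exact (by fun_prop : Continuous fun s => h' (y - s) * v s).aestronglyMeasurable
    · exact ae_of_all _ fun s hs z hz => hB (z, s) ⟨hz, Set.uIoc_subset_uIcc hs⟩
    · exact intervalIntegrable_const
    · refine ae_of_all _ fun s _ z _ => ?_
      exact ((hh (z - s)).comp_sub_const z s).mul_const (v s)
  have hcont : Continuous fun p : ℝ × ℝ => ∫ s in t₀..p.1, h' (p.2 - s) * v s :=
    intervalIntegral.continuous_parametric_intervalIntegral_of_continuous
      (f := fun (p : ℝ × ℝ) s => h' (p.2 - s) * v s) (by fun_prop) continuous_fst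
  have hF := hasStrictFDerivAt_uncurry_coprod (𝕜 := ℝ) (u := (t, t)) (f := f)
    (f₁ := fun x y => ContinuousLinearMap.toSpanSingleton ℝ (h (y - x) * v x))
    (f₂ := fun x y => ContinuousLinearMap.toSpanSingleton ℝ (∫ s in t₀..x, h' (y - s) * v s))
    (Eventually.of_forall fun p => (hint p.1 p.2).hasFDerivAt)
    (Eventually.of_forall fun p => (hpar p.1 p.2).hasFDerivAt)
    (by
      refine Continuous.continuousAt ?_
      exact (ContinuousLinearMap.toSpanSingletonCLE (𝕜 := ℝ) (E := ℝ)).continuous.comp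
        (by fun_prop : Continuous fun p : ℝ × ℝ => h (p.2 - p.1) * v p.1))
    (by
      refine Continuous.continuousAt ?_
      exact (ContinuousLinearMap.toSpanSingletonCLE (𝕜 := ℝ) (E := ℝ)).continuous.comp hcont)
  have hd : HasDerivAt (fun t : ℝ => (t, t)) ((1 : ℝ), (1 : ℝ)) t :=
    (hasDerivAt_id t).prodMk (hasDerivAt_id t)
  have := hF.hasFDerivAt.comp_hasDerivAt_of_eq t hd rfl
  refine HasDerivAt.congr_deriv (f := fun t => ∫ s in t₀..t, h (t - s) * v s) this ?_
  simp [Function.HasUncurry.uncurry]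

/-- The solution with zero initial data, integrated by parts. -/
noncomputable def forced (w : ℝ → ℝ) (t₀ : ℝ) : ℕ → ℝ → ℝ
  | 0, _ => 0
  | m + 1, t => green m 0 * (w t - w t₀) + ∫ s in t₀..t, greenDeriv m (t - s) * (w s - w t₀)

section forced

variable {w : ℝ → ℝ} (hw : Continuous w) (t₀ : ℝ)

include hw

lemma integral_greenDeriv_mul (m : ℕ) (t : ℝ) :
    ∫ s in t₀..t, greenDeriv m (t - s) * (w s - w t₀) =
      m * (∫ s in t₀..t, green (m - 1) (t - s) * (w s - w t₀)) -
      (m + 1) * ∫ s in t₀..t, green (m + 1) (t - s) * (w s - w t₀) := by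
  have hc := continuous_green
  have hi : ∀ j, IntervalIntegrable (fun s => green j (t - s) * (w s - w t₀)) volume t₀ t :=
    fun j => Continuous.intervalIntegrable (by have := hc j; fun_prop) _ _
  rw [← intervalIntegral.integral_const_mul, ← intervalIntegral.integral_const_mul,
    ← intervalIntegral.integral_sub ((hi _).const_mul _) ((hi _).const_mul _)]
  congr 1
  ext s
  rw [greenDeriv]
  ring

/-- The boundary term and the integral produced by the Leibniz rule are exactly the two terms of
`forced`. -/
lemma hasDerivAt_integral_green_mul (j : ℕ) (t : ℝ) :
    HasDerivAt (fun t => ∫ s in t₀..t, green j (t - s) * (w s - w t₀)) (forced w t₀ (j + 1) t) t :=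
  hasDerivAt_integral_convolution (hasDerivAt_green j) (continuous_greenDeriv j)
    (hw.sub continuous_const) t₀ t

lemma hasDerivAt_integral_greenDeriv_mul (m : ℕ) (t : ℝ) :
    HasDerivAt (fun t => ∫ s in t₀..t, greenDeriv m (t - s) * (w s - w t₀))
      (m * forced w t₀ m t - (m + 1) * forced w t₀ (m + 2) t) t := by
  rw [show (fun t => ∫ s in t₀..t, greenDeriv m (t - s) * (w s - w t₀)) = fun t =>
      m * (∫ s in t₀..t, green (m - 1) (t - s) * (w s - w t₀)) -
      (m + 1) * ∫ s in t₀..t, green (m + 1) (t - s) * (w s - w t₀) from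
    funext (integral_greenDeriv_mul hw t₀ m)]
  refine HasDerivAt.congr_deriv (((hasDerivAt_integral_green_mul hw t₀ (m - 1) t).const_mul _).sub
    ((hasDerivAt_integral_green_mul hw t₀ (m + 1) t).const_mul _)) ?_
  -- For m = 0 the truncated index m - 1 is wrong, but its coefficient vanishes.
  rcases m with _ | m
  · simp
  · simp

lemma continuous_forced (n : ℕ) : Continuous (forced w t₀ n) := by
  rcases n with _ | m
  · exact continuous_const
  · refine (continuous_const.mul (hw.sub continuous_const)).add ?_
    exact continuous_iff_continuousAt.2 fun t =>
      (hasDerivAt_integral_greenDeriv_mul hw t₀ m t).continuousAt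

lemma forced_equation (m : ℕ) (t : ℝ) :
    forced w t₀ (m + 1) t = (∫ s in t₀..t, (m * forced w t₀ m s - (m + 1) * forced w t₀ (m + 2) s))
      + (if m = 0 then w t - w t₀ else 0) := by
  have hc := continuous_forced hw t₀
  rw [intervalIntegral.integral_eq_sub_of_hasDerivAt
    (fun s _ => hasDerivAt_integral_greenDeriv_mul hw t₀ m s)
    (Continuous.intervalIntegrable (by have := hc m; have := hc (m + 2); fun_prop) _ _),
    forced, green_zero, intervalIntegral.integral_same]
  split_ifs <;> ring

lemma abs_forced_le (t₁ : ℝ) : ∃ C : ℝ, 0 ≤ C ∧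
    ∀ n, ∀ t ∈ Set.Icc t₀ t₁, |forced w t₀ n t| ≤ C * 2 ^ n := by
  obtain ⟨B, hB⟩ := (isCompact_Icc (a := t₀) (b := t₁)).exists_bound_of_continuousOn
    (f := fun s => w s - w t₀) (by fun_prop)
  refine ⟨|B| + 4 * |B| * |t₁ - t₀|, by positivity, fun n t ht => ?_⟩
  rcases n with _ | m
  · simp only [forced, abs_zero]; positivity
  have h1 : |green m 0 * (w t - w t₀)| ≤ |B| := by
    rw [abs_mul]
    have : |green m 0| ≤ 1 := by rw [green_zero]; split_ifs <;> simp
    calc |green m 0| * |w t - w t₀| ≤ 1 * |B| := by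
          exact mul_le_mul this ((hB t ht).trans (le_abs_self B)) (abs_nonneg _) zero_le_one
      _ = |B| := one_mul _
  have h2 : ‖∫ s in t₀..t, greenDeriv m (t - s) * (w s - w t₀)‖
      ≤ ((4 * m + 2) * |B|) * |t - t₀| := by
    refine intervalIntegral.norm_integral_le_of_norm_le_const fun s hs => ?_
    rw [Set.uIoc_of_le ht.1] at hs
    rw [norm_mul]
    have h3 : ‖greenDeriv m (t - s)‖ ≤ 4 * m + 2 := by
      refine (abs_greenDeriv_le m _).trans (mul_le_of_le_one_right (by positivity) ?_)
      exact Real.exp_le_one_iff.2 (neg_nonpos.2 (abs_nonneg _))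
    have h4 := (hB s ⟨hs.1.le, hs.2.trans ht.2⟩).trans (le_abs_self B)
    gcongr
  have h5 : |t - t₀| ≤ |t₁ - t₀| := by
    rw [abs_of_nonneg (sub_nonneg.2 ht.1)]
    exact (sub_le_sub_right ht.2 _).trans (le_abs_self _)
  have h6 : (4 * m + 2 : ℝ) ≤ 4 * 2 ^ (m + 1) := by
    have : ((m + 1 : ℕ) : ℝ) ≤ ((2 ^ (m + 1) : ℕ) : ℝ) := by exact_mod_cast Nat.lt_two_pow_self.le
    push_cast at this
    linarith
  have h7 : (1 : ℝ) ≤ 2 ^ (m + 1) := one_le_pow₀ (by norm_num)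
  calc |forced w t₀ (m + 1) t|
      ≤ |green m 0 * (w t - w t₀)| + |∫ s in t₀..t, greenDeriv m (t - s) * (w s - w t₀)| :=
        abs_add_le _ _
    _ ≤ |B| * 1 + ((4 * m + 2) * |B|) * |t - t₀| := by rw [mul_one]; exact add_le_add h1 h2
    _ ≤ |B| * 2 ^ (m + 1) + ((4 * 2 ^ (m + 1)) * |B|) * |t₁ - t₀| := by gcongr
    _ = (|B| + 4 * |B| * |t₁ - t₀|) * 2 ^ (m + 1) := by ring

/-- Recentring the path at w(t) instead of w(t₀) makes the integrand independent of t₀. The starting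
time survives only in the upper limit and in a boundary term that decays. -/
lemma forced_eq_reversed (m : ℕ) (t : ℝ) :
    forced w t₀ (m + 1) t = green m (t - t₀) * (w t - w t₀) -
      ∫ u in (0)..(t - t₀), greenDeriv m u * (w t - w (t - u)) := by
  have hg := continuous_greenDeriv m
  have e1 : ∫ s in t₀..t, greenDeriv m (t - s) * (w s - w t₀) =
      ∫ u in (0)..(t - t₀), greenDeriv m u * (w (t - u) - w t₀) := by
    have := intervalIntegral.integral_comp_sub_left
      (fun u => greenDeriv m u * (w (t - u) - w t₀)) t (a := t₀) (b := t)
    simpa using this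
  have e2 : ∫ u in (0)..(t - t₀), greenDeriv m u * (w (t - u) - w t₀) =
      ∫ u in (0)..(t - t₀), (greenDeriv m u * (w t - w t₀) -
        greenDeriv m u * (w t - w (t - u))) := by
    congr 1; ext u; ring
  have e3 : ∫ u in (0)..(t - t₀), greenDeriv m u = green m (t - t₀) - green m 0 :=
    intervalIntegral.integral_eq_sub_of_hasDerivAt (fun s _ => hasDerivAt_green m s)
      (hg.intervalIntegrable _ _)
  rw [forced, e1, e2, intervalIntegral.integral_sub
    (Continuous.intervalIntegrable (by fun_prop) _ _)
    (Continuous.intervalIntegrable (by fun_prop) _ _),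
    intervalIntegral.integral_mul_const, e3]
  ring

end forced

/-! ### Superposition of the noiseless flow and the forcing -/

/-- A family of functions with the derivatives that the first component of a homogeneous solution
with initial data `c` should have, together with growth bounds, yields a solution. -/
lemma isForcedSolution_tower_add_forced {w : ℝ → ℝ} (hw : Continuous w) (t₀ : ℝ) {α : ℕ+ → ℝ}
    {φ : ℕ → ℝ → ℝ} (hφ : ∀ τ, 0 ≤ τ → ∀ k, HasDerivAt (φ k) (φ (k + 1) τ) τ)
    (hφ0 : ∀ k, φ k 0 = (shiftOp^[k] fun m => α m.succPNat) 0)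
    (hbd : ∀ τ₁, ∃ C R : ℝ, 1 ≤ R ∧ ∀ τ ∈ Set.Icc 0 τ₁, ∀ k, |φ k τ| ≤ C * R ^ k * k.factorial) :
    IsForcedSolution w t₀ α (fun n t => tower φ n 0 (t - t₀) + forced w t₀ n t) where
  boundary t _ := by simp [tower, forced]
  initial n := by
    obtain ⟨m, rfl⟩ : ∃ m : ℕ, n = m.succPNat := ⟨n.natPred, by simp⟩
    have h := tower_zero_eq_iterate hφ0 m 0
    have hm : ((m.succPNat : ℕ+) : ℕ) = m + 1 := rfl
    simp only [hm, sub_self, h, forced, intervalIntegral.integral_same]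
    simp
  continuous n := by
    refine ContinuousOn.add ?_ (continuous_forced hw t₀ n).continuousOn
    intro t ht
    have h := (hasDerivAt_tower (hφ (t - t₀) (sub_nonneg.2 ht)) n 0).continuousAt
    exact (ContinuousAt.comp (f := fun t => t - t₀) h (by fun_prop)).continuousWithinAt
  equation n hn t ht := by
    obtain ⟨m, rfl⟩ : ∃ m, n = m + 1 := ⟨n - 1, by omega⟩
    have hcont : ∀ n k, ContinuousOn (fun s => tower φ n k (s - t₀)) (Set.uIcc t₀ t) := by
      intro n k s hs
      rw [Set.uIcc_of_le ht] at hs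
      have h := (hasDerivAt_tower (hφ (s - t₀) (sub_nonneg.2 hs.1)) n k).continuousAt
      exact (ContinuousAt.comp (f := fun t => t - t₀) h (by fun_prop)).continuousWithinAt
    have h1 : ∫ s in t₀..t, tower φ (m + 1) 1 (s - t₀) =
        tower φ (m + 1) 0 (t - t₀) - tower φ (m + 1) 0 (t₀ - t₀) := by
      refine intervalIntegral.integral_eq_sub_of_hasDerivAt
        (f := fun s => tower φ (m + 1) 0 (s - t₀)) (fun s hs => ?_)
        (hcont _ _).intervalIntegrable
      rw [Set.uIcc_of_le ht] at hs
      exact (hasDerivAt_tower (hφ (s - t₀) (sub_nonneg.2 hs.1)) (m + 1) 0).comp_sub_const s t₀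
    have hc := continuous_forced hw t₀
    have h2 := forced_equation hw t₀ m t
    have h3 : forced w t₀ (m + 1) t₀ = 0 := by simp [forced]
    have h4 : (∫ s in t₀..t, ((((m + 1 : ℕ) : ℝ) - 1) *
          (tower φ (m + 1 - 1) 0 (s - t₀) + forced w t₀ (m + 1 - 1) s) -
          ((m + 1 : ℕ) : ℝ) * (tower φ (m + 1 + 1) 0 (s - t₀) + forced w t₀ (m + 1 + 1) s))) =
        (∫ s in t₀..t, tower φ (m + 1) 1 (s - t₀)) +
          ∫ s in t₀..t, (m * forced w t₀ m s - (m + 1) * forced w t₀ (m + 2) s) := by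
      rw [← intervalIntegral.integral_add (hcont _ _).intervalIntegrable
        (Continuous.intervalIntegrable (by have := hc m; have := hc (m + 2); fun_prop) _ _)]
      congr 1
      ext s
      rw [tower_succ_right φ (m + 1) 0 _ (by omega)]
      push_cast
      ring
    rw [h4, h1, h2, h3]
    simp only [Nat.add_eq_right]
    ring
  growth t₁ ht₁ := by
    obtain ⟨C, R, hR, hCR⟩ := hbd (t₁ - t₀)
    obtain ⟨C', hC', hb⟩ := abs_forced_le hw t₀ t₁
    have hC : 0 ≤ C := by
      simpa using (abs_nonneg _).trans (hCR 0 ⟨le_rfl, sub_nonneg.2 ht₁⟩ 0)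
    refine ⟨C + C', 4 * R, fun n t ht => ?_⟩
    have h1 := abs_tower_le hR (hCR (t - t₀) ⟨sub_nonneg.2 ht.1, sub_le_sub_right ht.2 _⟩) n 0
    have h2 := hb n t ht
    have h3 : (n + 0).factorial / n.factorial = (1 : ℝ) := by
      rw [add_zero]; exact div_self (by positivity)
    rw [h3, pow_zero, mul_one, mul_one] at h1
    calc |tower φ n 0 (t - t₀) + forced w t₀ n t|
        ≤ |tower φ n 0 (t - t₀)| + |forced w t₀ n t| := abs_add_le _ _
      _ ≤ C * (4 * R) ^ n + C' * 2 ^ n := add_le_add h1 h2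
      _ ≤ C * (4 * R) ^ n + C' * (4 * R) ^ n := by gcongr; linarith
      _ = (C + C') * (4 * R) ^ n := by ring

/-! ### Generating functions and their generator -/

/-- The generator of the homogeneous system acting on generating functions. -/
noncomputable def genOp (G : ℂ → ℂ) (z : ℂ) : ℂ := z * G z + (z ^ 2 - 1) * deriv G z

/-- `G` is analytic near `(-1, 0]`, and analytic and bounded on a cone with vertex `-1`. -/
def IsConeBounded (G : ℂ → ℂ) : Prop :=
  (∀ x ∈ Set.Ioc (-1 : ℝ) 0, AnalyticAt ℂ G (x : ℂ)) ∧
  ∃ c > (0 : ℝ), ∃ d > (0 : ℝ), ∃ M : ℝ, ∀ r ∈ Set.Ioo 0 d, ∀ w : ℂ, ‖w - r‖ < c * r →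
    AnalyticAt ℂ G (-1 + w) ∧ ‖G (-1 + w)‖ ≤ M

lemma AnalyticAt_genOp {G : ℂ → ℂ} {z : ℂ} (h : AnalyticAt ℂ G z) : AnalyticAt ℂ (genOp G) z :=
  (analyticAt_id.mul h).add (((analyticAt_id.pow 2).sub analyticAt_const).mul h.deriv)

/-- In a cone of half the aperture, a disc of radius cr/2 about the point stays in the old cone, so
Cauchy gives a derivative of order 1/r. With z = -1 + w the factor z² - 1 = w(w - 2) is of order r
and compensates. -/
lemma IsConeBounded.genOp {G : ℂ → ℂ} (hG : IsConeBounded G) : IsConeBounded (genOp G) := by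
  obtain ⟨hA, c, hc, d, hd, M, hM⟩ := hG
  refine ⟨fun x hx => AnalyticAt_genOp (hA x hx), c / 2, by positivity, d, hd,
    (1 + (1 + c) * d) * M + ((1 + c) * ((1 + c) * d + 2)) * (2 * M / c), fun r hr w hw => ?_⟩
  have hr0 : 0 < r := hr.1
  have hw' : ‖w - r‖ < c * r := hw.trans_le (by nlinarith)
  obtain ⟨h1, h2⟩ := hM r hr w hw'
  have hM0 : 0 ≤ M := (norm_nonneg _).trans h2
  refine ⟨AnalyticAt_genOp h1, ?_⟩
  have hball : ∀ z ∈ Metric.closedBall (-1 + w) (c * r / 2), AnalyticAt ℂ G z ∧ ‖G z‖ ≤ M := by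
    intro z hz
    rw [mem_closedBall_iff_norm] at hz
    have := hM r hr (z + 1) (by
      calc ‖z + 1 - r‖ = ‖(z - (-1 + w)) + (w - r)‖ := by ring_nf
        _ ≤ ‖z - (-1 + w)‖ + ‖w - r‖ := norm_add_le _ _
        _ < c * r / 2 + c / 2 * r := add_lt_add_of_le_of_lt hz hw
        _ = c * r := by ring)
    rwa [show -1 + (z + 1) = z by ring] at this
  have hcr : 0 < c * r / 2 := by positivity
  have hder : ‖deriv G (-1 + w)‖ ≤ M / (c * r / 2) := by
    refine Complex.norm_deriv_le_of_forall_mem_sphere_norm_le hcr ?_ fun z hz =>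
      (hball z (Metric.sphere_subset_closedBall hz)).2
    refine DifferentiableOn.diffContOnCl ?_
    intro z hz
    exact (hball z (Metric.closure_ball_subset_closedBall hz)).1.differentiableAt.differentiableWithinAt
  have hwn : ‖w‖ ≤ (1 + c) * r := by
    calc ‖w‖ = ‖(w - r) + r‖ := by ring_nf
      _ ≤ ‖w - r‖ + ‖(r : ℂ)‖ := norm_add_le _ _
      _ ≤ c * r + r := by
        rw [Complex.norm_real, Real.norm_of_nonneg hr0.le]; gcongr
      _ = (1 + c) * r := by ring
  have hwd : ‖w‖ ≤ (1 + c) * d := hwn.trans (by have := hr.2.le; gcongr)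
  have hz1 : ‖-1 + w‖ ≤ 1 + (1 + c) * d := by
    calc ‖-1 + w‖ ≤ ‖(-1 : ℂ)‖ + ‖w‖ := norm_add_le _ _
      _ ≤ 1 + (1 + c) * d := by rw [norm_neg, norm_one]; gcongr
  have hz2 : ‖(-1 + w) ^ 2 - 1‖ ≤ (1 + c) * r * ((1 + c) * d + 2) := by
    calc ‖(-1 + w) ^ 2 - 1‖ = ‖w * (w - 2)‖ := by ring_nf
      _ = ‖w‖ * ‖w - 2‖ := norm_mul _ _
      _ ≤ (1 + c) * r * ((1 + c) * d + 2) := by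
        have h2 : ‖(2 : ℂ)‖ = 2 := by simp
        have : ‖w - 2‖ ≤ (1 + c) * d + 2 := (norm_sub_le _ _).trans (by rw [h2]; gcongr)
        gcongr
  calc ‖ShellModel.genOp G (-1 + w)‖
      ≤ ‖(-1 + w) * G (-1 + w)‖ + ‖((-1 + w) ^ 2 - 1) * deriv G (-1 + w)‖ := norm_add_le _ _
    _ = ‖-1 + w‖ * ‖G (-1 + w)‖ + ‖(-1 + w) ^ 2 - 1‖ * ‖deriv G (-1 + w)‖ := by
        rw [norm_mul, norm_mul]
    _ ≤ (1 + (1 + c) * d) * M + ((1 + c) * r * ((1 + c) * d + 2)) * (M / (c * r / 2)) := by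
        gcongr
    _ = _ := by field_simp

lemma IsConeBounded.iterate {G : ℂ → ℂ} (hG : IsConeBounded G) (k : ℕ) :
    IsConeBounded (ShellModel.genOp^[k] G) := by
  induction k with
  | zero => exact hG
  | succ k ih => rw [Function.iterate_succ_apply']; exact ih.genOp

/-- `∑ c k z ^ k` is the power series of `G` at `0`. -/
def HasSeries (G : ℂ → ℂ) (c : ℕ → ℝ) : Prop :=
  ∀ᶠ z in 𝓝 (0 : ℂ), HasSum (fun k : ℕ => (c k : ℂ) * z ^ k) (G z)

lemma HasSeries.apply_zero {G : ℂ → ℂ} {c : ℕ → ℝ} (h : HasSeries G c) : G 0 = c 0 := by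
  have h0 := h.self_of_nhds
  refine h0.unique ?_
  convert hasSum_single (f := fun k : ℕ => (c k : ℂ) * 0 ^ k) 0 (fun k hk => by simp [hk]) using 1
  simp

lemma HasSeries.hasFPowerSeriesAt {G : ℂ → ℂ} {c : ℕ → ℝ} (h : HasSeries G c) :
    HasFPowerSeriesAt G (FormalMultilinearSeries.ofScalars ℂ fun k => (c k : ℂ)) 0 := by
  rw [hasFPowerSeriesAt_iff]
  filter_upwards [h] with z hz
  simpa [FormalMultilinearSeries.coeff_ofScalars, mul_comm] using hz

lemma HasSeries.deriv {G : ℂ → ℂ} {c : ℕ → ℝ} (h : HasSeries G c) :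
    HasSeries (deriv G) (fun k => (k + 1) * c (k + 1)) := by
  have hA : AnalyticAt ℂ G 0 := ⟨_, h.hasFPowerSeriesAt⟩
  have e := h.hasFPowerSeriesAt.eq_formalMultilinearSeries hA.hasFPowerSeriesAt
  have hc : ∀ k, (c k : ℂ) = iteratedDeriv k G 0 / k.factorial := by
    intro k
    have := congrArg (fun p => p.coeff k) e
    simpa [FormalMultilinearSeries.coeff_ofScalars] using this
  have h2 := hasFPowerSeriesAt_iff.1 hA.deriv.hasFPowerSeriesAt
  unfold HasSeries
  filter_upwards [h2] with z hz
  simp only [zero_add, FormalMultilinearSeries.coeff_ofScalars, smul_eq_mul] at hz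
  convert! hz using 2 with k
  push_cast
  rw [hc, ← iteratedDeriv_succ', Nat.factorial_succ]
  have : (k.factorial : ℂ) ≠ 0 := by exact_mod_cast k.factorial_ne_zero
  have : (k + 1 : ℂ) ≠ 0 := by exact_mod_cast k.succ_ne_zero
  push_cast
  field_simp

lemma HasSeries.genOp {G : ℂ → ℂ} {c : ℕ → ℝ} (h : HasSeries G c) :
    HasSeries (genOp G) (shiftOp c) := by
  have hd := h.deriv
  unfold HasSeries at *
  filter_upwards [h, hd] with z hz hdz
  have s1 : HasSum (fun k : ℕ => if k = 0 then 0 else (c (k - 1) : ℂ) * z ^ k) (z * G z) := by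
    rw [hasSum_nat_add_iff' 1 |>.symm]
    simpa [pow_succ, mul_comm, mul_assoc, mul_left_comm] using hz.mul_left z
  -- The coefficient k - 1 also vanishes at k = 1, so the first two terms drop out and a shift by 2
  -- leaves the series of the derivative.
  have s2 : HasSum (fun k : ℕ => if k = 0 then 0 else ((k - 1 : ℝ) : ℂ) * c (k - 1) * z ^ k)
      (z ^ 2 * _root_.deriv G z) := by
    have := hdz.mul_left (z ^ 2)
    rw [hasSum_nat_add_iff' 2 |>.symm]
    convert! this using 1
    · ext k
      simp only [Nat.add_eq_zero_iff, OfNat.ofNat_ne_zero, and_false, if_false,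
        show k + 2 - 1 = k + 1 from rfl]
      push_cast
      ring
    · simp [Finset.sum_range_succ]
  convert! (s1.add s2).sub hdz using 1
  · ext k
    rcases k with _ | k
    · simp [shiftOp]
    · simp only [shiftOp, Nat.add_eq_zero_iff, one_ne_zero, and_false, if_false,
        Nat.add_sub_cancel]
      push_cast
      ring
  · rw [ShellModel.genOp]; ring

lemma HasSeries.iterate {G : ℂ → ℂ} {c : ℕ → ℝ} (h : HasSeries G c) (k : ℕ) :
    HasSeries (ShellModel.genOp^[k] G) (shiftOp^[k] c) := by
  induction k with
  | zero => exact h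
  | succ k ih => rw [Function.iterate_succ_apply', Function.iterate_succ_apply']; exact ih.genOp

/-! ### The first component along the characteristics -/

/-- The first component, as a function of complex time, of the homogeneous solution with initial
generating function `G`. -/
noncomputable def firstMode (G : ℂ → ℂ) (τ : ℂ) : ℂ := G (-Complex.tanh τ) / Complex.cosh τ

/-- The complex times at which `firstMode G` is analytic by construction. -/
def modeDomain (G : ℂ → ℂ) : Set ℂ :=
  {τ | Complex.cosh τ ≠ 0 ∧ AnalyticAt ℂ G (-Complex.tanh τ)}

lemma hasDerivAt_complex_tanh {τ : ℂ} (h : Complex.cosh τ ≠ 0) :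
    HasDerivAt Complex.tanh (1 - Complex.tanh τ ^ 2) τ := by
  have h' := (Complex.hasDerivAt_sinh τ).div (Complex.hasDerivAt_cosh τ) h
  have e : Complex.tanh = Complex.sinh / Complex.cosh := by
    ext x; exact Complex.tanh_eq_sinh_div_cosh x
  rw [e]
  refine h'.congr_deriv ?_
  rw [Pi.div_apply]
  field_simp

/-- With z = -tanh τ one has z' = z² - 1, and the logarithmic derivative of 1/cosh τ is z; the
product rule therefore reproduces the two terms of `genOp`. -/
lemma hasDerivAt_firstMode {G : ℂ → ℂ} {τ : ℂ} (hτ : τ ∈ modeDomain G) :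
    HasDerivAt (firstMode G) (firstMode (genOp G) τ) τ := by
  obtain ⟨h1, h2⟩ := hτ
  have h3 : HasDerivAt (fun τ => G (-Complex.tanh τ))
      (deriv G (-Complex.tanh τ) * -(1 - Complex.tanh τ ^ 2)) τ :=
    h2.differentiableAt.hasDerivAt.comp τ (hasDerivAt_complex_tanh h1).neg
  refine HasDerivAt.congr_deriv (f := firstMode G) (h3.div (Complex.hasDerivAt_cosh τ) h1) ?_
  have e : Complex.sinh τ = Complex.tanh τ * Complex.cosh τ := by
    rw [Complex.tanh_eq_sinh_div_cosh]; field_simp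
  simp only [firstMode, genOp, e]
  field_simp
  ring

lemma isOpen_modeDomain (G : ℂ → ℂ) : IsOpen (modeDomain G) := by
  rw [isOpen_iff_eventually]
  rintro τ ⟨h1, h2⟩
  have h3 : ContinuousAt (fun τ => -Complex.tanh τ) τ :=
    (hasDerivAt_complex_tanh h1).continuousAt.neg
  filter_upwards [Complex.continuous_cosh.continuousAt.eventually_ne h1,
    h3.eventually h2.eventually_analyticAt] with z hz hz'
  exact ⟨hz, hz'⟩

lemma modeDomain_subset_iterate (G : ℂ → ℂ) (k : ℕ) :
    modeDomain G ⊆ modeDomain (genOp^[k] G) := by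
  induction k with
  | zero => exact subset_rfl
  | succ k ih =>
    rw [Function.iterate_succ_apply']
    exact fun τ hτ => ⟨(ih hτ).1, AnalyticAt_genOp (ih hτ).2⟩

lemma iteratedDeriv_firstMode (G : ℂ → ℂ) (k : ℕ) : ∀ τ ∈ modeDomain G,
    iteratedDeriv k (firstMode G) τ = firstMode (genOp^[k] G) τ := by
  induction k with
  | zero => intro τ _; simp
  | succ k ih =>
    intro τ hτ
    have : iteratedDeriv k (firstMode G) =ᶠ[𝓝 τ] firstMode (genOp^[k] G) := by
      filter_upwards [(isOpen_modeDomain G).mem_nhds hτ] with z hz using ih z hz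
    rw [iteratedDeriv_succ, this.deriv_eq, Function.iterate_succ_apply']
    exact (hasDerivAt_firstMode (modeDomain_subset_iterate G k hτ)).deriv

lemma ofReal_mem_modeDomain {G : ℂ → ℂ} (hG : ∀ x ∈ Set.Ioc (-1 : ℝ) 0, AnalyticAt ℂ G (x : ℂ))
    {τ : ℝ} (hτ : 0 ≤ τ) : (τ : ℂ) ∈ modeDomain G := by
  constructor
  · rw [← Complex.ofReal_cosh]
    exact_mod_cast (Real.cosh_pos τ).ne'
  · rw [← Complex.ofReal_tanh, ← Complex.ofReal_neg]
    refine hG _ ⟨neg_lt_neg (Real.tanh_lt_one τ), neg_nonpos.2 ?_⟩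
    rw [Real.tanh_eq_sinh_div_cosh]
    exact div_nonneg (Real.sinh_nonneg_iff.2 hτ) (Real.cosh_pos τ).le

/-- The derivatives of the first component of the homogeneous solution. -/
noncomputable def modeDeriv (G : ℂ → ℂ) (k : ℕ) (τ : ℝ) : ℝ := (firstMode (genOp^[k] G) τ).re

lemma hasDerivAt_modeDeriv {G : ℂ → ℂ} (hG : IsConeBounded G) {τ : ℝ} (hτ : 0 ≤ τ) (k : ℕ) :
    HasDerivAt (modeDeriv G k) (modeDeriv G (k + 1) τ) τ := by
  have := (hasDerivAt_firstMode (ofReal_mem_modeDomain (hG.iterate k).1 hτ)).real_of_complex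
  rwa [← Function.iterate_succ_apply' ShellModel.genOp k G] at this

lemma modeDeriv_zero {G : ℂ → ℂ} {c : ℕ → ℝ} (h : HasSeries G c) (k : ℕ) :
    modeDeriv G k 0 = (shiftOp^[k] c) 0 := by
  simp [modeDeriv, firstMode, (h.iterate k).apply_zero]

/-- The real time segment is compact in the open set `modeDomain G`, so `firstMode G` is bounded on
a complex δ-neighbourhood of it. Cauchy's estimates on discs of radius δ give R = max 1 δ⁻¹
uniformly in τ. -/
lemma abs_modeDeriv_le {G : ℂ → ℂ} (hG : IsConeBounded G) (τ₁ : ℝ) :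
    ∃ C R : ℝ, 1 ≤ R ∧ ∀ τ ∈ Set.Icc 0 τ₁, ∀ k, |modeDeriv G k τ| ≤ C * R ^ k * k.factorial := by
  have hK : IsCompact ((fun τ : ℝ => (τ : ℂ)) '' Set.Icc 0 τ₁) :=
    isCompact_Icc.image Complex.continuous_ofReal
  have hsub : (fun τ : ℝ => (τ : ℂ)) '' Set.Icc 0 τ₁ ⊆ modeDomain G := by
    rintro _ ⟨τ, hτ, rfl⟩
    exact ofReal_mem_modeDomain hG.1 hτ.1
  obtain ⟨δ, hδ, hth⟩ := hK.exists_cthickening_subset_open (isOpen_modeDomain G) hsub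
  obtain ⟨M, hM⟩ := (hK.cthickening (r := δ)).exists_bound_of_continuousOn (f := firstMode G)
    fun z hz => (hasDerivAt_firstMode (hth hz)).continuousAt.continuousWithinAt
  refine ⟨M, max 1 δ⁻¹, le_max_left _ _, fun τ hτ k => ?_⟩
  have hmem : (τ : ℂ) ∈ (fun τ : ℝ => (τ : ℂ)) '' Set.Icc 0 τ₁ := ⟨τ, hτ, rfl⟩
  have hball : Metric.closedBall (τ : ℂ) δ ⊆
      Metric.cthickening δ ((fun τ : ℝ => (τ : ℂ)) '' Set.Icc 0 τ₁) :=
    Metric.closedBall_subset_cthickening hmem δ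
  have hC := Complex.norm_iteratedDeriv_le_of_forall_mem_sphere_norm_le (f := firstMode G)
    (c := (τ : ℂ)) (R := δ) (C := M) k hδ
    (DifferentiableOn.diffContOnCl fun z hz => (hasDerivAt_firstMode (hth (hball
      (Metric.closure_ball_subset_closedBall hz)))).differentiableAt.differentiableWithinAt)
    fun z hz => hM z (hball (Metric.sphere_subset_closedBall hz))
  rw [iteratedDeriv_firstMode G k _ (hsub hmem)] at hC
  have hM0 : 0 ≤ M := (norm_nonneg _).trans (hM _ (hball (Metric.mem_closedBall_self hδ.le)))
  calc |modeDeriv G k τ| ≤ ‖firstMode (genOp^[k] G) τ‖ := Complex.abs_re_le_norm _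
    _ ≤ k.factorial * M / δ ^ k := hC
    _ = M * δ⁻¹ ^ k * k.factorial := by rw [inv_pow]; ring
    _ ≤ M * max 1 δ⁻¹ ^ k * k.factorial := by gcongr; exact le_max_right _ _

lemma tendsto_real_tanh_atTop : Tendsto Real.tanh atTop (𝓝 1) := by
  have h1 : ∀ x, Real.tanh x = 1 - 2 / (Real.exp (2 * x) + 1) := by
    intro x
    rw [Real.tanh_eq, Real.exp_neg, two_mul, Real.exp_add]
    have := Real.exp_pos x
    field_simp
    ring
  rw [show Real.tanh = fun x => 1 - 2 / (Real.exp (2 * x) + 1) from funext h1]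
  have h2 : Tendsto (fun x : ℝ => Real.exp (2 * x) + 1) atTop atTop :=
    tendsto_atTop_add_const_right _ _
      (Real.tendsto_exp_atTop.comp (tendsto_id.const_mul_atTop two_pos))
  simpa using (h2.const_div_atTop 2).const_sub 1

lemma tendsto_modeDeriv {G : ℂ → ℂ} (hG : IsConeBounded G) (k : ℕ) :
    Tendsto (modeDeriv G k) atTop (𝓝 0) := by
  obtain ⟨_, c, hc, d, hd, M, hM⟩ := hG.iterate k
  have hcosh : Tendsto (fun τ : ℝ => M / Real.cosh τ) atTop (𝓝 0) :=
    Tendsto.const_div_atTop (tendsto_atTop_mono (fun x => by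
      rw [Real.cosh_eq]
      have := Real.exp_pos (-x)
      linarith) (Real.tendsto_exp_atTop.atTop_div_const two_pos)) M
  refine squeeze_zero_norm' ?_ hcosh
  have h1 : ∀ᶠ τ in atTop, 1 - d < Real.tanh τ :=
    tendsto_real_tanh_atTop.eventually_const_lt (by linarith)
  filter_upwards [h1] with τ hτ
  -- The point -tanh τ = -1 + r is the centre of the disc at scale r = 1 - tanh τ, hence lies in the
  -- cone as soon as r < d.
  have hr : 1 - Real.tanh τ ∈ Set.Ioo 0 d := ⟨sub_pos.2 (Real.tanh_lt_one τ), by linarith⟩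
  have h2 := (hM _ hr ((1 - Real.tanh τ : ℝ) : ℂ) (by
    rw [sub_self, norm_zero]; exact mul_pos hc hr.1)).2
  have h3 : (-1 + ((1 - Real.tanh τ : ℝ) : ℂ)) = -Complex.tanh τ := by
    push_cast; ring
  rw [h3] at h2
  calc ‖modeDeriv G k τ‖ ≤ ‖firstMode (genOp^[k] G) τ‖ := Complex.abs_re_le_norm _
    _ = ‖genOp^[k] G (-Complex.tanh τ)‖ / Real.cosh τ := by
        rw [firstMode, norm_div, ← Complex.ofReal_cosh, Complex.norm_real,
          Real.norm_of_nonneg (Real.cosh_pos τ).le]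
    _ ≤ M / Real.cosh τ := by have := Real.cosh_pos τ; gcongr

/-- The generating function of an admissible sequence is bounded on a cone. -/
lemma IsAdmissible.exists_isConeBounded {α : ℕ+ → ℝ} (hα : IsAdmissible α) :
    ∃ G, IsConeBounded G ∧ HasSeries G (fun m => α m.succPNat) := by
  obtain ⟨G, h1, h2, _, δ, hδ, θ, hθ, M, hM⟩ := hα
  refine ⟨G, ⟨h2, ?_⟩, h1⟩
  -- The argument is invariant under positive scaling, so continuity at 1 places every disc of
  -- radius cr about r inside the sector.
  have harg : ContinuousAt Complex.arg 1 := Complex.continuousAt_arg (by simp)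
  have hev : ∀ᶠ z in 𝓝 (1 : ℂ), |Complex.arg z| < θ := by
    have := harg.abs
    exact this.eventually_lt_const (by simpa using hθ)
  obtain ⟨c, hc, hball⟩ := Metric.eventually_nhds_iff_ball.1 hev
  -- The cap 1/2 gives r/2 < ‖w‖ < 3r/2, so w is nonzero; together with r < δ/2 it gives ‖w‖ < δ.
  refine ⟨min c (1 / 2), by positivity, δ / 2, by positivity, M, fun r hr w hw => ?_⟩
  have hr0 := hr.1
  have hr0' : (r : ℂ) ≠ 0 := by exact_mod_cast hr0.ne'
  have hrn : ‖(r : ℂ)‖ = r := by rw [Complex.norm_real, Real.norm_of_nonneg hr0.le]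
  have hw1 : ‖w - r‖ < r / 2 := hw.trans_le (by
    have := min_le_right c (1 / 2)
    nlinarith)
  have hw2 : ‖w - r‖ < c * r := hw.trans_le (by
    have := min_le_left c (1 / 2)
    gcongr)
  have e : -1 + w + 1 = w := by ring
  have := hM (-1 + w)
  rw [e] at this
  refine this ?_ ?_ ?_
  · have h3 : ‖(r : ℂ)‖ ≤ ‖w‖ + ‖w - r‖ := by
      calc ‖(r : ℂ)‖ = ‖w - (w - r)‖ := by ring_nf
        _ ≤ _ := norm_sub_le _ _
    linarith
  · have h3 : ‖w‖ ≤ ‖w - r‖ + ‖(r : ℂ)‖ := by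
      calc ‖w‖ = ‖(w - r) + r‖ := by ring_nf
        _ ≤ _ := norm_add_le _ _
    have := hr.2
    linarith
  · have h3 : w / r ∈ Metric.ball (1 : ℂ) c := by
      rw [mem_ball_iff_norm, div_sub_one hr0', norm_div, hrn, div_lt_iff₀ hr0]
      exact hw2
    have h4 := hball _ h3
    rwa [div_eq_inv_mul, ← Complex.ofReal_inv, Complex.arg_real_mul _ (inv_pos.2 hr0)] at h4

/-- The homogeneous solution, as a function of the elapsed time, together with its properties. -/
lemma IsAdmissible.exists_solution {α : ℕ+ → ℝ} (hα : IsAdmissible α) :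
    ∃ a : ℕ → ℝ → ℝ, (∀ n, Tendsto (a n) atTop (𝓝 0)) ∧
      ∀ w : ℝ → ℝ, Continuous w → ∀ t₀,
        IsForcedSolution w t₀ α (fun n t => a n (t - t₀) + forced w t₀ n t) := by
  obtain ⟨G, hG, hs⟩ := hα.exists_isConeBounded
  exact ⟨fun n => tower (modeDeriv G) n 0, fun n => tendsto_tower (tendsto_modeDeriv hG) n 0,
    fun w hw t₀ => isForcedSolution_tower_add_forced hw t₀
      (fun τ hτ k => hasDerivAt_modeDeriv hG hτ k) (modeDeriv_zero hs) (abs_modeDeriv_le hG)⟩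

/-! ### Pathwise limit as the starting time recedes -/

/-- The path-by-path value of the stochastic integral of `green m (t - s)` over `(-∞, t]`,
after an integration by parts. -/
noncomputable def pathIntegral (w : ℝ → ℝ) (m : ℕ) (t : ℝ) : ℝ :=
  -∫ u in Set.Ioi (0 : ℝ), greenDeriv m u * (w t - w (t - u))

/-- The elementary integral of a step function approximating `green m (t - s)`. -/
noncomputable def riemannSum (w : ℝ → ℝ) (m : ℕ) (t : ℝ) (M : ℕ) : ℝ :=
  ∑ i ∈ Finset.range (M * M), green m (i / M) * (w (t - i / M) - w (t - (i + 1) / M))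

/-- Linear growth is traded for exp(u/2), half the decay rate of `green`, so that products with the
kernels still decay like exp(-u/2). -/
lemma exists_abs_increment_le {w : ℝ → ℝ} {C : ℝ} (hC : ∀ s, |w s| ≤ C * (1 + |s|)) (t : ℝ) :
    ∃ D, 0 ≤ D ∧ ∀ u, 0 ≤ u → |w t - w (t - u)| ≤ D * Real.exp (u / 2) := by
  have hC0 : 0 ≤ C := by simpa using (abs_nonneg _).trans (hC 0)
  refine ⟨C * (1 + |t|) + C * (2 + |t|), by positivity, fun u hu => ?_⟩
  have h1 : 1 + u / 2 ≤ Real.exp (u / 2) := by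
    have := Real.add_one_le_exp (u / 2); linarith
  have h3 : |t - u| ≤ |t| + u := by
    calc |t - u| ≤ |t| + |u| := abs_sub _ _
      _ = |t| + u := by rw [abs_of_nonneg hu]
  have h4 : 1 + |t - u| ≤ (2 + |t|) * Real.exp (u / 2) := by
    nlinarith [abs_nonneg t, mul_le_mul_of_nonneg_left h1 (abs_nonneg t)]
  have h5 : 1 ≤ Real.exp (u / 2) := by linarith
  calc |w t - w (t - u)| ≤ |w t| + |w (t - u)| := abs_sub _ _
    _ ≤ C * (1 + |t|) + C * (1 + |t - u|) := add_le_add (hC _) (hC _)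
    _ ≤ C * (1 + |t|) * Real.exp (u / 2) + C * ((2 + |t|) * Real.exp (u / 2)) := by
        refine add_le_add (le_mul_of_one_le_right (by positivity) h5) (by gcongr)
    _ = _ := by ring

lemma tendsto_green_mul {V : ℝ → ℝ} {D : ℝ} (hV : ∀ u, 0 ≤ u → |V u| ≤ D * Real.exp (u / 2))
    (m : ℕ) : Tendsto (fun u => green m u * V u) atTop (𝓝 0) := by
  have h0 : Tendsto (fun u : ℝ => 2 * D * Real.exp (-(u / 2))) atTop (𝓝 0) := by
    simpa using ((Real.tendsto_exp_neg_atTop_nhds_zero.comp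
      (tendsto_id.atTop_div_const two_pos)).const_mul (2 * D))
  refine squeeze_zero_norm' ?_ h0
  filter_upwards [eventually_ge_atTop 0] with u hu
  have h1 := abs_green_le m u
  rw [abs_of_nonneg hu] at h1
  rw [norm_mul]
  calc ‖green m u‖ * ‖V u‖ ≤ (2 * Real.exp (-u)) * (D * Real.exp (u / 2)) :=
        mul_le_mul h1 (hV u hu) (norm_nonneg _) (by positivity)
    _ = 2 * D * (Real.exp (-u) * Real.exp (u / 2)) := by ring
    _ = 2 * D * Real.exp (-(u / 2)) := by rw [← Real.exp_add]; ring_nf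

lemma abs_greenDeriv_mul_le {u v D : ℝ} (hu : 0 ≤ u) (hv : |v| ≤ D * Real.exp (u / 2)) (m : ℕ) :
    ‖greenDeriv m u * v‖ ≤ (4 * m + 2) * D * Real.exp (-(1 / 2) * u) := by
  have h1 := abs_greenDeriv_le m u
  rw [abs_of_nonneg hu] at h1
  rw [norm_mul]
  calc ‖greenDeriv m u‖ * ‖v‖ ≤ ((4 * m + 2) * Real.exp (-u)) * (D * Real.exp (u / 2)) :=
        mul_le_mul h1 hv (norm_nonneg _) (by positivity)
    _ = (4 * m + 2) * D * (Real.exp (-u) * Real.exp (u / 2)) := by ring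
    _ = _ := by rw [← Real.exp_add]; ring_nf

lemma integrableOn_exp_bound (B : ℝ) :
    IntegrableOn (fun u : ℝ => B * Real.exp (-(1 / 2) * u)) (Set.Ioi 0) :=
  (integrableOn_exp_mul_Ioi (by norm_num : -(1 / 2 : ℝ) < 0) 0).const_mul B

lemma integrableOn_greenDeriv_mul {V : ℝ → ℝ} {D : ℝ} (hVc : Continuous V)
    (hV : ∀ u, 0 ≤ u → |V u| ≤ D * Real.exp (u / 2)) (m : ℕ) :
    IntegrableOn (fun u => greenDeriv m u * V u) (Set.Ioi 0) := by
  refine (integrableOn_exp_bound ((4 * m + 2) * D)).mono'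
    ((continuous_greenDeriv m).mul hVc).aestronglyMeasurable ?_
  exact (ae_restrict_iff' measurableSet_Ioi).2 (ae_of_all _ fun u hu =>
    abs_greenDeriv_mul_le (le_of_lt hu) (hV u (le_of_lt hu)) m)

/-- In the form of `forced_eq_reversed` the boundary term tends to zero and the integral extends to
the half-line, where its integrand is integrable. -/
lemma tendsto_forced {w : ℝ → ℝ} (hw : Continuous w) {C : ℝ} (hC : ∀ s, |w s| ≤ C * (1 + |s|))
    (m : ℕ) (t : ℝ) :
    Tendsto (fun T => forced w (-T) (m + 1) t) atTop (𝓝 (pathIntegral w m t)) := by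
  obtain ⟨D, hD, hV⟩ := exists_abs_increment_le hC t
  have hτ : Tendsto (fun T : ℝ => t - -T) atTop atTop := by
    simpa using tendsto_atTop_add_const_left atTop t tendsto_id
  have h1 := (tendsto_green_mul (V := fun u => w t - w (t - u)) hV m).comp hτ
  have h2 := (intervalIntegral_tendsto_integral_Ioi 0
    (integrableOn_greenDeriv_mul (V := fun u => w t - w (t - u)) (by fun_prop) hV m) hτ)
  have := h1.sub h2
  rw [zero_sub] at this
  refine this.congr fun T => ?_
  rw [forced_eq_reversed hw]
  simp

/-- Summation by parts. -/
lemma riemannSum_eq (w : ℝ → ℝ) (m : ℕ) (t : ℝ) {M : ℕ} (hM : 0 < M) :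
    riemannSum w m t M = green m M * (w t - w (t - M)) -
      ∫ u in (0)..M, greenDeriv m u * (w t - w (t - ⌈M * u⌉₊ / M)) := by
  have hM' : (0 : ℝ) < M := by exact_mod_cast hM
  let a : ℕ → ℝ := fun i => i / M
  have hpiece : ∀ i : ℕ, ∀ u ∈ Set.uIoc (a i) (a (i + 1)),
      greenDeriv m u * (w t - w (t - ⌈M * u⌉₊ / M)) = greenDeriv m u * (w t - w (t - a (i + 1))) := by
    intro i u hu
    rw [Set.uIoc_of_le (by simp only [a]; gcongr; omega)] at hu
    have : ⌈M * u⌉₊ = i + 1 := by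
      rw [Nat.ceil_eq_iff (by omega)]
      have h1 := hu.1
      have h2 := hu.2
      simp only [a] at h1 h2
      rw [div_lt_iff₀ hM'] at h1
      rw [le_div_iff₀ hM'] at h2
      simp only [Nat.add_sub_cancel]
      push_cast at h2 ⊢
      constructor <;> linarith
    rw [this]
  have hII : ∀ i : ℕ, IntervalIntegrable
      (fun u => greenDeriv m u * (w t - w (t - ⌈M * u⌉₊ / M))) volume (a i) (a (i + 1)) := by
    intro i
    have : IntervalIntegrable (fun u => greenDeriv m u * (w t - w (t - a (i + 1)))) volume
        (a i) (a (i + 1)) :=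
      ((continuous_greenDeriv m).mul continuous_const).intervalIntegrable _ _
    exact this.congr fun u hu => (hpiece i u hu).symm
  have hval : ∀ i : ℕ, ∫ u in (a i)..(a (i + 1)), greenDeriv m u * (w t - w (t - ⌈M * u⌉₊ / M)) =
      (green m (a (i + 1)) - green m (a i)) * (w t - w (t - a (i + 1))) := by
    intro i
    rw [intervalIntegral.integral_congr_ae (ae_of_all _ (hpiece i)),
      intervalIntegral.integral_mul_const, intervalIntegral.integral_eq_sub_of_hasDerivAt
        (fun s _ => hasDerivAt_green m s) ((continuous_greenDeriv m).intervalIntegrable _ _)]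
  have hN : a (M * M) = M := by simp only [a]; push_cast; field_simp
  have h0 : a 0 = 0 := by simp [a]
  have hsum := intervalIntegral.sum_integral_adjacent_intervals (n := M * M) fun i _ => hII i
  rw [hN, h0] at hsum
  rw [← hsum]
  -- Abel summation for the increments w(t) - w(t - u), which vanish at u = 0, so only the far
  -- boundary term remains.
  have key : ∀ N, ∑ i ∈ Finset.range N, green m (a i) * (w (t - a i) - w (t - a (i + 1))) =
      green m (a N) * (w t - w (t - a N)) - ∑ i ∈ Finset.range N,
        (green m (a (i + 1)) - green m (a i)) * (w t - w (t - a (i + 1))) := by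
    intro N
    induction N with
    | zero => simp [h0]
    | succ N ih => rw [Finset.sum_range_succ, Finset.sum_range_succ, ih]; ring
  have := key (M * M)
  rw [hN] at this
  rw [Finset.sum_congr rfl fun i _ => hval i, ← this, riemannSum]
  simp only [a]
  push_cast
  rfl

/-- Summation by parts turns the sum into the integral defining `pathIntegral` with the path sampled
on a grid. Continuity of the path and dominated convergence remove the grid. -/
lemma tendsto_riemannSum {w : ℝ → ℝ} (hw : Continuous w) {C : ℝ}
    (hC : ∀ s, |w s| ≤ C * (1 + |s|)) (m : ℕ) (t : ℝ) :
    Tendsto (fun M : ℕ => riemannSum w m t (M + 1)) atTop (𝓝 (pathIntegral w m t)) := by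
  obtain ⟨D, hD, hV⟩ := exists_abs_increment_le hC t
  suffices h : Tendsto (fun M : ℕ => green m M * (w t - w (t - M)) -
      ∫ u in (0)..M, greenDeriv m u * (w t - w (t - ⌈M * u⌉₊ / M))) atTop
      (𝓝 (pathIntegral w m t)) by
    refine ((tendsto_add_atTop_iff_nat 1).2 h).congr fun M => ?_
    rw [riemannSum_eq w m t (Nat.succ_pos M)]
  have h1 := (tendsto_green_mul (V := fun u => w t - w (t - u)) hV m).comp
    tendsto_natCast_atTop_atTop
  rw [pathIntegral, ← zero_sub]
  refine h1.sub ?_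
  have h2 : ∀ M : ℕ, ∫ u in (0)..M, greenDeriv m u * (w t - w (t - ⌈M * u⌉₊ / M)) =
      ∫ u in Set.Ioi (0 : ℝ), (Set.Iic (M : ℝ)).indicator
        (fun u => greenDeriv m u * (w t - w (t - ⌈M * u⌉₊ / M))) u := by
    intro M
    rw [intervalIntegral.integral_of_le (Nat.cast_nonneg M),
      setIntegral_indicator measurableSet_Iic, Set.Ioi_inter_Iic]
  simp_rw [h2]
  refine tendsto_integral_of_dominated_convergence
    -- The grid point ⌈Mu⌉/M is at most u + 1, which costs a factor exp(1/2) in the increment bound.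
    (fun u => (4 * m + 2) * (D * Real.exp (1 / 2)) * Real.exp (-(1 / 2) * u)) ?_
    (integrableOn_exp_bound _) ?_ ?_
  · intro M
    refine (Measurable.indicator ?_ measurableSet_Iic).aestronglyMeasurable
    have h3 : Measurable fun u : ℝ => ((⌈M * u⌉₊ : ℕ) : ℝ) / M :=
      (measurable_from_nat.comp (Nat.measurable_ceil.comp (measurable_const_mul _))).div_const _
    exact (continuous_greenDeriv m).measurable.mul
      (measurable_const.sub (hw.measurable.comp (measurable_const.sub h3)))
  · intro M
    refine (ae_restrict_iff' measurableSet_Ioi).2 (ae_of_all _ fun u hu => ?_)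
    have hu0 : (0 : ℝ) < u := hu
    by_cases huM : u ≤ M
    · rw [Set.indicator_of_mem (show u ∈ Set.Iic (M : ℝ) from huM)]
      have hM : (0 : ℝ) < M := hu0.trans_le huM
      have hM1 : (1 : ℝ) ≤ M := by
        have : 0 < M := by exact_mod_cast hM
        exact_mod_cast this
      refine abs_greenDeriv_mul_le hu0.le ((hV _ (by positivity)).trans ?_) m
      rw [mul_assoc, ← Real.exp_add]
      have h4 : (⌈M * u⌉₊ : ℝ) / M ≤ u + 1 := by
        rw [div_le_iff₀ hM]
        have := (Nat.ceil_lt_add_one (by positivity : 0 ≤ M * u)).le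
        nlinarith
      gcongr
      linarith
    · rw [Set.indicator_of_notMem (by simpa using huM), norm_zero]
      positivity
  · refine (ae_restrict_iff' measurableSet_Ioi).2 (ae_of_all _ fun u hu => ?_)
    have hu0 : (0 : ℝ) < u := hu
    have h5 : Tendsto (fun M : ℕ => (⌈(M : ℝ) * u⌉₊ : ℝ) / M) atTop (𝓝 u) := by
      have := (tendsto_nat_ceil_mul_div_atTop hu0.le).comp (tendsto_natCast_atTop_atTop (R := ℝ))
      refine this.congr fun M => ?_
      simp [mul_comm]
    have h6 : Tendsto (fun M : ℕ => greenDeriv m u * (w t - w (t - ⌈(M : ℝ) * u⌉₊ / M))) atTop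
        (𝓝 (greenDeriv m u * (w t - w (t - u)))) :=
      (tendsto_const_nhds.sub ((hw.tendsto _).comp (tendsto_const_nhds.sub h5))).const_mul _
    refine h6.congr' ?_
    filter_upwards [(tendsto_natCast_atTop_atTop (R := ℝ)).eventually_ge_atTop u] with M hM
    rw [Set.indicator_of_mem (show u ∈ Set.Iic (M : ℝ) from hM)]

/-! ### Continuity and linear growth of Brownian paths -/

lemma identDistrib_comp_of_isPreBrownianReal {Ω : Type*} [MeasurableSpace Ω] {P : Measure Ω}
    [IsProbabilityMeasure P] {X Y : ℝ≥0 → Ω → ℝ} (hX : IsPreBrownianReal X P)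
    (hY : IsPreBrownianReal Y P) (q : ℕ → ℝ≥0) :
    IdentDistrib (fun ω k => X (q k) ω) (fun ω k => Y (q k) ω) P P := by
  classical
  rw [identDistrib_iff_forall_finset_identDistrib
    (X := fun k ω => X (q k) ω) (Y := fun k ω => Y (q k) ω)
    (aemeasurable_pi_lambda _ fun k => hX.aemeasurable _)
    (aemeasurable_pi_lambda _ fun k => hY.aemeasurable _)]
  intro I
  have h := (hX.hasLaw (I.image q)).identDistrib (hY.hasLaw (I.image q))
  exact h.comp (u := fun (x : I.image q → ℝ) (i : I) =>
    x ⟨q i, Finset.mem_image_of_mem q i.2⟩) (by fun_prop)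

/-- Brownian motion grows at most linearly. -/
lemma exists_abs_le_of_isBrownianReal {Ω : Type*} [MeasurableSpace Ω] {P : Measure Ω}
    [IsProbabilityMeasure P] {B : ℝ≥0 → Ω → ℝ} (hB : IsBrownianReal B P) :
    ∀ᵐ ω ∂P, ∃ C : ℝ, ∀ t, |B t ω| ≤ C * (1 + t) := by
  let d := TopologicalSpace.denseSeq ℝ≥0
  -- Time inversion: t B(1/t) has the law of B, so boundedness near zero transfers to linear growth
  -- at infinity. Only countably many dense times are used, which makes the event measurable; path
  -- continuity fills in the rest.
  have hid := identDistrib_comp_of_isPreBrownianReal hB.toIsPreBrownianReal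
    hB.toIsPreBrownianReal.inv fun k => 1 / d k
  let E : Set (ℕ → ℝ) := {x | ∃ n : ℕ, ∀ k, 1 / d k ≤ 1 / (n + 1) → |x k| ≤ 1}
  have hE : MeasurableSet E := by
    have : E = ⋃ n : ℕ, ⋂ k, {x : ℕ → ℝ | 1 / d k ≤ 1 / (n + 1) → |x k| ≤ 1} := by
      ext x; simp [E]
    rw [this]
    refine MeasurableSet.iUnion fun n => MeasurableSet.iInter fun k => ?_
    by_cases h : 1 / d k ≤ 1 / ((n : ℝ≥0) + 1)
    · simp only [h, true_imp_iff]
      exact measurableSet_le (by fun_prop) measurable_const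
    · simp only [h, false_imp_iff, Set.ofPred_true, MeasurableSet.univ]
  have h1 : ∀ᵐ ω ∂P, (fun k => B (1 / d k) ω) ∈ E := by
    filter_upwards [hB.tendsto_nhds_zero] with ω hω
    have h2 : ∀ᶠ s in 𝓝 (0 : ℝ≥0), |B s ω| < 1 := by
      have := hω.abs
      rw [abs_zero] at this
      exact this.eventually_lt_const one_pos
    obtain ⟨ε, hε, hball⟩ := Metric.eventually_nhds_iff_ball.1 h2
    obtain ⟨n, hn⟩ := exists_nat_one_div_lt hε
    refine ⟨n, fun k hk => (hball _ ?_).le⟩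
    rw [Metric.mem_ball, NNReal.dist_eq, NNReal.coe_zero, sub_zero, NNReal.abs_eq]
    refine lt_of_le_of_lt ?_ hn
    exact_mod_cast hk
  have h2 := hid.ae_mem_snd hE h1
  filter_upwards [h2, hB.cont] with ω hω hc
  obtain ⟨n, hn⟩ := hω
  have hd : ∀ k, (n : ℝ≥0) + 1 < d k → |B (d k) ω| ≤ d k := by
    intro k hk
    have hk0 : 0 < d k := lt_of_le_of_lt (by positivity) hk
    have := hn k (one_div_le_one_div_of_le (by positivity) hk.le)
    simp only [one_div_one_div] at this
    rw [abs_mul, NNReal.abs_eq] at this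
    push_cast at this
    have hk0' : (0 : ℝ) < d k := hk0
    rwa [one_div, inv_mul_le_iff₀ hk0', mul_one] at this
  have hall : ∀ t, (n : ℝ≥0) + 1 < t → |B t ω| ≤ t := by
    have hcl : IsClosed {t : ℝ≥0 | |B t ω| ≤ t} :=
      isClosed_le (by fun_prop) (by fun_prop)
    intro t ht
    have hmem := (TopologicalSpace.denseRange_denseSeq ℝ≥0).open_subset_closure_inter
      (isOpen_Ioi (a := (n : ℝ≥0) + 1)) ht
    refine closure_minimal ?_ hcl hmem
    rintro _ ⟨hx, k, rfl⟩
    exact hd k hx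
  obtain ⟨C, hC⟩ := (isCompact_Icc (a := (0 : ℝ≥0)) (b := (n : ℝ≥0) + 1)).exists_bound_of_continuousOn
    hc.continuousOn
  refine ⟨max C 1, fun t => ?_⟩
  have h1 := le_max_left C 1
  have h2 := le_max_right C 1
  have ht : (0 : ℝ) ≤ t := t.2
  by_cases hcase : t ≤ (n : ℝ≥0) + 1
  · have := hC t ⟨zero_le, hcase⟩
    rw [Real.norm_eq_abs] at this
    nlinarith
  · have := hall t (not_le.1 hcase)
    nlinarith

section path

variable {Ω : Type*} [MeasurableSpace Ω] {P : Measure Ω} {W : ℝ → Ω → ℝ}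

lemma IsTwoSidedBrownian.ae_continuous (hW : IsTwoSidedBrownian W P) :
    ∀ᵐ ω ∂P, Continuous fun s => W s ω := by
  filter_upwards [hW.forward.cont, hW.backward.cont] with ω h1 h2
  have h1' : ContinuousOn (fun s => W s ω) (Set.Ici 0) := by
    have : ContinuousOn (fun s : ℝ => W ((s.toNNReal : ℝ≥0) : ℝ) ω) (Set.Ici 0) :=
      (h1.comp continuous_real_toNNReal).continuousOn
    refine this.congr fun s hs => ?_
    simp only
    rw [Real.coe_toNNReal s hs]
  have h2' : ContinuousOn (fun s => W s ω) (Set.Iic 0) := by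
    have : ContinuousOn (fun s : ℝ => W (-(((-s).toNNReal : ℝ≥0) : ℝ)) ω) (Set.Iic 0) :=
      (h2.comp (continuous_real_toNNReal.comp continuous_neg)).continuousOn
    refine this.congr fun s hs => ?_
    simp only
    rw [Real.coe_toNNReal (-s) (neg_nonneg.2 hs), neg_neg]
  rw [← continuousOn_univ, ← Set.Iic_union_Ici (a := (0 : ℝ))]
  exact h2'.union_of_isClosed h1' isClosed_Iic isClosed_Ici

lemma IsTwoSidedBrownian.ae_abs_le [IsProbabilityMeasure P] (hW : IsTwoSidedBrownian W P) :
    ∀ᵐ ω ∂P, ∃ C : ℝ, ∀ s, |W s ω| ≤ C * (1 + |s|) := by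
  filter_upwards [exists_abs_le_of_isBrownianReal hW.forward,
    exists_abs_le_of_isBrownianReal hW.backward] with ω ⟨C, hC⟩ ⟨C', hC'⟩
  refine ⟨max C C', fun s => ?_⟩
  rcases le_total 0 s with hs | hs
  · have := hC s.toNNReal
    rw [Real.coe_toNNReal s hs] at this
    rw [abs_of_nonneg hs]
    exact this.trans (by gcongr; exact le_max_left _ _)
  · have := hC' (-s).toNNReal
    rw [Real.coe_toNNReal (-s) (neg_nonneg.2 hs), neg_neg] at this
    rw [abs_of_nonpos hs]
    exact this.trans (mul_le_mul_of_nonneg_right (le_max_right _ _) (by linarith))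

end path

/-! ### Gaussian law and isometry of elementary integrals -/

section gauss

variable {Ω : Type*} [MeasurableSpace Ω] {P : Measure Ω} {W : ℝ → Ω → ℝ}

lemma IsTwoSidedBrownian.isGaussianProcess (hW : IsTwoSidedBrownian W P) :
    IsGaussianProcess W P where
  hasGaussianLaw I := by
    classical
    let p : ℝ → ℝ≥0 := fun s => s.toNNReal
    let q : ℝ → ℝ≥0 := fun s => (-s).toNNReal
    have h1 := hW.forward.isGaussianProcess.hasGaussianLaw (I.image p)
    have h2 := hW.backward.isGaussianProcess.hasGaussianLaw (I.image q)
    have hind : IndepFun (fun ω => (I.image p).restrict fun t : ℝ≥0 => W (t : ℝ) ω)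
        (fun ω => (I.image q).restrict fun t : ℝ≥0 => W (-(t : ℝ)) ω) P :=
      hW.indep.comp (Finset.measurable_restrict _) (Finset.measurable_restrict _)
    have h := hind.hasGaussianLaw h1 h2
    let L : ((I.image p → ℝ) × (I.image q → ℝ)) →L[ℝ] (I → ℝ) :=
      ContinuousLinearMap.pi fun i => if 0 ≤ (i : ℝ) then
        (ContinuousLinearMap.proj ⟨p i, Finset.mem_image_of_mem p i.2⟩).comp
          (ContinuousLinearMap.fst ℝ _ _)
      else (ContinuousLinearMap.proj ⟨q i, Finset.mem_image_of_mem q i.2⟩).comp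
          (ContinuousLinearMap.snd ℝ _ _)
    convert! h.map L using 1
    ext ω i
    simp only [L, Function.comp_apply, ContinuousLinearMap.pi_apply, Finset.restrict]
    split_ifs with hi
    · simp [p, Real.coe_toNNReal _ hi]
    · have : 0 ≤ -(i : ℝ) := by linarith [not_le.1 hi]
      simp [q, Real.coe_toNNReal _ this]

lemma IsTwoSidedBrownian.memLp (hW : IsTwoSidedBrownian W P) (s : ℝ) : MemLp (W s) 2 P :=
  (hW.isGaussianProcess.hasGaussianLaw_eval s).memLp_two

lemma IsTwoSidedBrownian.integral_eq_zero (hW : IsTwoSidedBrownian W P) (s : ℝ) :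
    ∫ ω, W s ω ∂P = 0 := by
  rcases le_total 0 s with hs | hs
  · simpa [Real.coe_toNNReal _ hs] using hW.forward.integral_eval s.toNNReal
  · simpa [Real.coe_toNNReal _ (neg_nonneg.2 hs)] using hW.backward.integral_eval (-s).toNNReal

/-- A single formula for all signs. In the covariance of two increments the terms |s| and |t|
cancel, leaving the distances that measure the overlap of the intervals in
`integral_indicator_Ioc_mul`. -/
lemma IsTwoSidedBrownian.integral_mul (hW : IsTwoSidedBrownian W P) (s t : ℝ) :
    ∫ ω, W s ω * W t ω ∂P = (|s| + |t| - |s - t|) / 2 := by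
  have := hW.isGaussianProcess.isProbabilityMeasure
  have hcov : ∀ s t, ∫ ω, W s ω * W t ω ∂P = cov[W s, W t; P] := by
    intro s t
    rw [covariance_eq_sub (hW.memLp s) (hW.memLp t), hW.integral_eq_zero, zero_mul, sub_zero]
    rfl
  have hmix : ∀ s t, 0 ≤ s → t ≤ 0 → ∫ ω, W s ω * W t ω ∂P = 0 := by
    intro s t hs ht
    have hi : IndepFun (W s) (W t) P := by
      have := hW.indep.comp (measurable_pi_apply s.toNNReal) (measurable_pi_apply (-t).toNNReal)
      simpa [Function.comp_def, Real.coe_toNNReal _ hs, Real.coe_toNNReal _ (neg_nonneg.2 ht)]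
        using this
    rw [hi.integral_fun_mul_eq_mul_integral (hW.memLp s).aestronglyMeasurable
      (hW.memLp t).aestronglyMeasurable, hW.integral_eq_zero, zero_mul]
  rcases le_total 0 s with hs | hs <;> rcases le_total 0 t with ht | ht
  · have := hW.forward.covariance_eval s.toNNReal t.toNNReal
    simp only [Real.coe_toNNReal _ hs, Real.coe_toNNReal _ ht, NNReal.coe_min] at this
    rw [hcov]
    refine Eq.trans this ?_
    rw [abs_of_nonneg hs, abs_of_nonneg ht]
    rcases le_total s t with h | h
    · rw [min_eq_left h, abs_of_nonpos (by linarith)]; ring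
    · rw [min_eq_right h, abs_of_nonneg (by linarith)]; ring
  · rw [hmix s t hs ht, abs_of_nonneg hs, abs_of_nonpos ht, abs_of_nonneg (by linarith)]; ring
  · simp_rw [mul_comm (W s _)]
    rw [hmix t s ht hs, abs_of_nonneg ht, abs_of_nonpos hs, abs_of_nonpos (by linarith)]; ring
  · have := hW.backward.covariance_eval (-s).toNNReal (-t).toNNReal
    simp only [Real.coe_toNNReal _ (neg_nonneg.2 hs), Real.coe_toNNReal _ (neg_nonneg.2 ht),
      NNReal.coe_min, neg_neg] at this
    rw [hcov]
    refine Eq.trans this ?_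
    rw [abs_of_nonpos hs, abs_of_nonpos ht]
    rcases le_total s t with h | h
    · rw [min_eq_right (by linarith), abs_of_nonpos (by linarith)]; ring
    · rw [min_eq_left (by linarith), abs_of_nonneg (by linarith)]; ring

lemma integral_indicator_Ioc_mul {l r l' r' : ℝ} (h : l ≤ r) (h' : l' ≤ r') :
    ∫ x, (Set.Ioc l r).indicator (fun _ => (1 : ℝ)) x * (Set.Ioc l' r').indicator (fun _ => 1) x =
      (|r - l'| + |l - r'| - |r - r'| - |l - l'|) / 2 := by
  have e : (fun x => (Set.Ioc l r).indicator (fun _ => (1 : ℝ)) x *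
      (Set.Ioc l' r').indicator (fun _ => 1) x) =
      (Set.Ioc (max l l') (min r r')).indicator fun _ => 1 := by
    rw [← Set.Ioc_inter_Ioc]
    ext x
    simp only [Set.indicator, Set.mem_inter_iff]
    by_cases h1 : x ∈ Set.Ioc l r <;> by_cases h2 : x ∈ Set.Ioc l' r' <;> simp [h1, h2]
  rw [e, integral_indicator measurableSet_Ioc]
  simp only [integral_const, smul_eq_mul, mul_one, MeasurableSet.univ, measureReal_restrict_apply,
    Set.univ_inter, Real.volume_real_Ioc]
  rcases le_total r l' with h1 | h1 <;> rcases le_total l r' with h2 | h2 <;>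
    rcases le_total r r' with h3 | h3 <;> rcases le_total l l' with h4 | h4 <;>
    simp only [h3, h4, max_eq_left, max_eq_right, min_eq_left, min_eq_right, abs_of_nonneg,
      abs_of_nonpos, sub_nonneg, sub_nonpos, h1, h2] <;>
    first
    | linarith
    | rw [max_eq_left (by linarith)]; linarith

lemma IsTwoSidedBrownian.integral_increment_mul (hW : IsTwoSidedBrownian W P)
    {l r l' r' : ℝ} (h : l ≤ r) (h' : l' ≤ r') :
    ∫ ω, (W r ω - W l ω) * (W r' ω - W l' ω) ∂P =
      ∫ x, (Set.Ioc l r).indicator (fun _ => (1 : ℝ)) x *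
        (Set.Ioc l' r').indicator (fun _ => 1) x := by
  have hi : ∀ s t, Integrable (fun ω => W s ω * W t ω) P := fun s t =>
    (hW.memLp s).integrable_mul (hW.memLp t)
  have e : (fun ω => (W r ω - W l ω) * (W r' ω - W l' ω)) = fun ω =>
      (W r ω * W r' ω - W r ω * W l' ω) - (W l ω * W r' ω - W l ω * W l' ω) := by
    ext ω; ring
  have hi2 : ∀ s t u, Integrable (fun ω => W s ω * W t ω - W s ω * W u ω) P := fun s t u =>
    (hi s t).sub (hi s u)
  rw [e, integral_sub (hi2 _ _ _) (hi2 _ _ _),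
    integral_sub (hi _ _) (hi _ _), integral_sub (hi _ _) (hi _ _), hW.integral_mul,
    hW.integral_mul, hW.integral_mul, hW.integral_mul, integral_indicator_Ioc_mul h h']
  ring

lemma integrable_indicator_Ioc_mul (l r l' r' : ℝ) :
    Integrable fun x => (Set.Ioc l r).indicator (fun _ => (1 : ℝ)) x *
      (Set.Ioc l' r').indicator (fun _ => 1) x := by
  have hm : ∀ l r : ℝ, MemLp ((Set.Ioc l r).indicator fun _ => (1 : ℝ)) 2 := fun l r =>
    memLp_indicator_const 2 measurableSet_Ioc 1 (Or.inr (by simp))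
  exact (hm l r).integrable_mul (hm l' r')

/-- The isometry and the law of elementary integrals. -/
lemma IsTwoSidedBrownian.hasLaw_sum (hW : IsTwoSidedBrownian W P) {ι : Type*} [Fintype ι]
    (c l r : ι → ℝ) (hlr : ∀ i, l i ≤ r i) :
    HasLaw (fun ω => ∑ i, c i * (W (r i) ω - W (l i) ω))
      (gaussianReal 0 (∫ x, (∑ i, (Set.Ioc (l i) (r i)).indicator (fun _ => c i) x) ^ 2).toNNReal)
      P := by
  classical
  have := hW.isGaussianProcess.isProbabilityMeasure
  set S : Ω → ℝ := fun ω => ∑ i, c i * (W (r i) ω - W (l i) ω) with hS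
  have hG : HasGaussianLaw S P := by
    let J : Finset ℝ := Finset.univ.image r ∪ Finset.univ.image l
    have hr : ∀ i, r i ∈ J := fun i => by simp [J]
    have hl : ∀ i, l i ∈ J := fun i => by simp [J]
    let e : J → (J → ℝ) →L[ℝ] ℝ := fun j => ContinuousLinearMap.proj j
    let L : (J → ℝ) →L[ℝ] ℝ := ∑ i, c i • (e ⟨r i, hr i⟩ - e ⟨l i, hl i⟩)
    have := (hW.isGaussianProcess.hasGaussianLaw J).map L
    convert! this using 1
    ext ω
    simp [S, L, e, Finset.restrict]
  have hmem : ∀ i, MemLp (fun ω => W (r i) ω - W (l i) ω) 2 P := fun i =>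
    (hW.memLp _).sub (hW.memLp _)
  have hprod : ∀ i j, Integrable (fun ω => (c i * c j) *
      ((W (r i) ω - W (l i) ω) * (W (r j) ω - W (l j) ω))) P := fun i j =>
    ((hmem i).integrable_mul (hmem j)).const_mul _
  have hmean : ∫ ω, S ω ∂P = 0 := by
    rw [hS, integral_finsetSum _ fun i _ =>
      ((hmem i).integrable (by norm_num)).const_mul _]
    refine Finset.sum_eq_zero fun i _ => ?_
    rw [integral_const_mul, integral_sub ((hW.memLp _).integrable (by norm_num))
      ((hW.memLp _).integrable (by norm_num)), hW.integral_eq_zero, hW.integral_eq_zero]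
    simp
  have hsq : ∫ ω, S ω ^ 2 ∂P =
      ∫ x, (∑ i, (Set.Ioc (l i) (r i)).indicator (fun _ => c i) x) ^ 2 := by
    have e1 : ∀ ω, S ω ^ 2 = ∑ i, ∑ j, (c i * c j) *
        ((W (r i) ω - W (l i) ω) * (W (r j) ω - W (l j) ω)) := by
      intro ω
      rw [sq, hS, Finset.sum_mul_sum]
      refine Finset.sum_congr rfl fun i _ => Finset.sum_congr rfl fun j _ => by ring
    have e2 : ∀ x, (∑ i, (Set.Ioc (l i) (r i)).indicator (fun _ => c i) x) ^ 2 =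
        ∑ i, ∑ j, (c i * c j) * ((Set.Ioc (l i) (r i)).indicator (fun _ => (1 : ℝ)) x *
          (Set.Ioc (l j) (r j)).indicator (fun _ => 1) x) := by
      intro x
      rw [sq, Finset.sum_mul_sum]
      refine Finset.sum_congr rfl fun i _ => Finset.sum_congr rfl fun j _ => ?_
      simp only [Set.indicator]
      split_ifs <;> simp
    simp_rw [e1, e2]
    rw [integral_finsetSum _ fun i _ => integrable_finsetSum _ fun j _ =>
        hprod i j,
      integral_finsetSum _ fun i _ => integrable_finsetSum _ fun j _ =>
        (integrable_indicator_Ioc_mul _ _ _ _).const_mul _]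
    refine Finset.sum_congr rfl fun i _ => ?_
    rw [integral_finsetSum _ fun j _ => hprod i j,
      integral_finsetSum _ fun j _ => (integrable_indicator_Ioc_mul _ _ _ _).const_mul _]
    refine Finset.sum_congr rfl fun j _ => ?_
    rw [integral_const_mul, integral_const_mul, hW.integral_increment_mul (hlr i) (hlr j)]
  refine ⟨hG.aemeasurable, ?_⟩
  rw [hG.map_eq_gaussianReal, hmean, variance_of_integral_eq_zero hG.aemeasurable hmean, hsq]

end gauss

/-! ### Auxiliary facts on L² norms and step functions -/

lemma toReal_eLpNorm_two_sq {X : Type*} [MeasurableSpace X] {μ : Measure X} {f : X → ℝ}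
    (hf : MemLp f 2 μ) : (eLpNorm f 2 μ).toReal ^ 2 = ∫ x, f x ^ 2 ∂μ := by
  have h0 : 0 ≤ ∫ x, f x ^ 2 ∂μ := integral_nonneg fun x => sq_nonneg _
  rw [hf.eLpNorm_eq_integral_rpow_norm (by norm_num) (by norm_num)]
  simp only [ENNReal.toReal_ofNat, Real.rpow_ofNat, Real.norm_eq_abs, sq_abs]
  rw [ENNReal.toReal_ofReal (Real.rpow_nonneg h0 _), ← Real.rpow_natCast, ← Real.rpow_mul h0]
  norm_num

lemma eLpNorm_two_eq {X Y : Type*} [MeasurableSpace X] [MeasurableSpace Y] {μ : Measure X}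
    {ν : Measure Y} {f : X → ℝ} {g : Y → ℝ} (hf : MemLp f 2 μ) (hg : MemLp g 2 ν)
    (h : ∫ x, f x ^ 2 ∂μ = ∫ y, g y ^ 2 ∂ν) : eLpNorm f 2 μ = eLpNorm g 2 ν := by
  rw [← ENNReal.toReal_eq_toReal_iff' hf.eLpNorm_ne_top hg.eLpNorm_ne_top,
    ← sq_eq_sq₀ ENNReal.toReal_nonneg ENNReal.toReal_nonneg, toReal_eLpNorm_two_sq hf,
    toReal_eLpNorm_two_sq hg, h]

lemma tendsto_integral_sq {X : Type*} [MeasurableSpace X] {μ : Measure X} {f : X → ℝ}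
    {g : ℕ → X → ℝ} (hf : MemLp f 2 μ) (hg : ∀ k, MemLp (g k) 2 μ)
    (h : Tendsto (fun k => eLpNorm (fun x => f x - g k x) 2 μ) atTop (𝓝 0)) :
    Tendsto (fun k => ∫ x, g k x ^ 2 ∂μ) atTop (𝓝 (∫ x, f x ^ 2 ∂μ)) := by
  have h1 : Tendsto (fun k => eLpNorm (g k - f) 2 μ) atTop (𝓝 0) := by
    refine h.congr fun k => ?_
    rw [← eLpNorm_neg]
    congr 1
    ext x
    simp
  have h2 := ((Lp.tendsto_Lp_iff_tendsto_eLpNorm'' g hg f hf).2 h1).norm.pow 2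
  simpa only [Lp.norm_toLp, toReal_eLpNorm_two_sq (hg _), toReal_eLpNorm_two_sq hf] using h2

lemma integral_add_sq {X : Type*} [MeasurableSpace X] {μ : Measure X} {u v : X → ℝ}
    (hu : MemLp u 2 μ) (hv : MemLp v 2 μ) :
    ∫ x, (u x + v x) ^ 2 ∂μ =
      (∫ x, u x ^ 2 ∂μ) + 2 * (∫ x, u x * v x ∂μ) + ∫ x, v x ^ 2 ∂μ := by
  have i1 : Integrable (fun x => u x ^ 2) μ := hu.integrable_sq
  have i2 : Integrable (fun x => v x ^ 2) μ := hv.integrable_sq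
  have i3 : Integrable (fun x => 2 * (u x * v x)) μ := (hu.integrable_mul hv).const_mul 2
  rw [← integral_const_mul, ← integral_add i1 i3,
    ← integral_add (f := fun x => u x ^ 2 + 2 * (u x * v x)) (i1.add i3) i2]
  congr 1
  ext x
  ring

namespace StepFunction

/-- A finite linear combination of step functions. -/
noncomputable def linComb {κ : Type*} [Fintype κ] (a : κ → ℝ) (g : κ → StepFunction) :
    StepFunction where
  size := Fintype.card (Σ k, Fin (g k).size)
  c i := a ((Fintype.equivFin _).symm i).1 * (g _).c ((Fintype.equivFin _).symm i).2
  l i := (g _).l ((Fintype.equivFin (Σ k, Fin (g k).size)).symm i).2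
  r i := (g _).r ((Fintype.equivFin (Σ k, Fin (g k).size)).symm i).2
  l_le_r _ := (g _).l_le_r _

lemma toFun_linComb {κ : Type*} [Fintype κ] (a : κ → ℝ) (g : κ → StepFunction) (x : ℝ) :
    (linComb a g).toFun x = ∑ k, a k * (g k).toFun x := by
  have h := Equiv.sum_comp (Fintype.equivFin (Σ k, Fin (g k).size)).symm fun p =>
    (Set.Ioc ((g p.1).l p.2) ((g p.1).r p.2)).indicator (fun _ => a p.1 * (g p.1).c p.2) x
  refine Eq.trans h ?_
  rw [Fintype.sum_sigma]
  refine Finset.sum_congr rfl fun k _ => ?_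
  rw [toFun, Finset.mul_sum]
  refine Finset.sum_congr rfl fun i _ => ?_
  simp only [Set.indicator]
  split_ifs <;> simp

lemma integral_linComb {κ : Type*} [Fintype κ] (a : κ → ℝ) (g : κ → StepFunction)
    {Ω : Type*} (W : ℝ → Ω → ℝ) (ω : Ω) :
    (linComb a g).integral W ω = ∑ k, a k * (g k).integral W ω := by
  have h := Equiv.sum_comp (Fintype.equivFin (Σ k, Fin (g k).size)).symm fun p =>
    a p.1 * (g p.1).c p.2 * (W ((g p.1).r p.2) ω - W ((g p.1).l p.2) ω)
  refine Eq.trans h ?_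
  rw [Fintype.sum_sigma]
  refine Finset.sum_congr rfl fun k _ => ?_
  rw [integral, Finset.mul_sum]
  exact Finset.sum_congr rfl fun i _ => mul_assoc _ _ _

lemma memLp_toFun (g : StepFunction) : MemLp g.toFun 2 volume := by
  have : g.toFun = fun x => ∑ i, (Set.Ioc (g.l i) (g.r i)).indicator (fun _ => g.c i) x := rfl
  rw [this]
  exact memLp_finsetSum _ fun i _ => memLp_indicator_const 2 measurableSet_Ioc _ (Or.inr (by simp))

end StepFunction

/-! ### Wiener integrals: law, linearity, isometry -/

section wiener

variable {Ω : Type*} [MeasurableSpace Ω] {P : Measure Ω} {W : ℝ → Ω → ℝ}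

lemma IsTwoSidedBrownian.hasLaw_integral (hW : IsTwoSidedBrownian W P) (g : StepFunction) :
    HasLaw (g.integral W) (gaussianReal 0 (∫ x, g.toFun x ^ 2).toNNReal) P :=
  hW.hasLaw_sum g.c g.l g.r g.l_le_r

lemma memLp_of_hasLaw_gaussianReal {X : Ω → ℝ} {v : ℝ≥0} (h : HasLaw X (gaussianReal 0 v) P) :
    MemLp X 2 P := h.hasGaussianLaw.memLp_two

lemma integral_of_hasLaw_gaussianReal {X : Ω → ℝ} {v : ℝ≥0} (h : HasLaw X (gaussianReal 0 v) P) :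
    ∫ ω, X ω ∂P = 0 := by
  rw [h.integral_eq, integral_id_gaussianReal]

lemma integral_sq_of_hasLaw_gaussianReal {X : Ω → ℝ} {v : ℝ≥0}
    (h : HasLaw X (gaussianReal 0 v) P) : ∫ ω, X ω ^ 2 ∂P = v := by
  rw [← variance_of_integral_eq_zero h.aemeasurable (integral_of_hasLaw_gaussianReal h),
    h.variance_eq, variance_id_gaussianReal]

/-- The isometry for elementary integrals. -/
lemma IsTwoSidedBrownian.eLpNorm_integral (hW : IsTwoSidedBrownian W P) (g : StepFunction) :
    eLpNorm (g.integral W) 2 P = eLpNorm g.toFun 2 volume := by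
  have h := hW.hasLaw_integral g
  refine eLpNorm_two_eq (memLp_of_hasLaw_gaussianReal h) g.memLp_toFun ?_
  rw [integral_sq_of_hasLaw_gaussianReal h,
    Real.coe_toNNReal _ (integral_nonneg fun x => sq_nonneg _)]

lemma IsTwoSidedBrownian.eLpNorm_integral_sub (hW : IsTwoSidedBrownian W P)
    (g h : StepFunction) :
    eLpNorm (fun ω => g.integral W ω - h.integral W ω) 2 P =
      eLpNorm (fun x => g.toFun x - h.toFun x) 2 volume := by
  have := hW.eLpNorm_integral (StepFunction.linComb ![1, -1] ![g, h])
  have e1 : (StepFunction.linComb ![1, -1] ![g, h]).integral W =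
      fun ω => g.integral W ω - h.integral W ω := by
    ext ω; rw [StepFunction.integral_linComb]; simp [Fin.sum_univ_two, sub_eq_add_neg]
  have e2 : (StepFunction.linComb ![1, -1] ![g, h]).toFun = fun x => g.toFun x - h.toFun x := by
    ext ω; rw [StepFunction.toFun_linComb]; simp [Fin.sum_univ_two, sub_eq_add_neg]
  rwa [e1, e2] at this

/-- A Wiener integral is a centered Gaussian variable. -/
lemma IsWienerIntegral.hasLaw (hW : IsTwoSidedBrownian W P) {f : ℝ → ℝ} {I : Ω → ℝ}
    (h : IsWienerIntegral W P f I) : HasLaw I (gaussianReal 0 (∫ x, f x ^ 2).toNNReal) P := by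
  have := hW.isGaussianProcess.isProbabilityMeasure
  obtain ⟨hf, hI, g, hg, hgI⟩ := h
  refine ⟨hI.aemeasurable, ?_⟩
  have hlaw := fun k => hW.hasLaw_integral (g k)
  -- Convergence in L² gives an almost surely convergent subsequence. Along it the characteristic
  -- functions converge by domination, while the Gaussian variances converge by L² convergence of
  -- the step functions.
  have hmeas : TendstoInMeasure P (fun k => (g k).integral W) atTop I := by
    refine tendstoInMeasure_of_tendsto_eLpNorm (p := 2) (by norm_num)
      (fun k => (hlaw k).aemeasurable.aestronglyMeasurable) hI.aestronglyMeasurable ?_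
    refine hgI.congr fun k => ?_
    rw [← eLpNorm_neg]
    congr 1
    ext x
    simp
  obtain ⟨ns, hns, hae⟩ := hmeas.exists_seq_tendsto_ae
  have hmap := P.isProbabilityMeasure_map hI.aemeasurable
  refine Measure.ext_of_charFun (funext fun t => ?_)
  have hchar : ∀ X : Ω → ℝ, AEMeasurable X P →
      charFun (P.map X) t = ∫ ω, Complex.exp (t * X ω * Complex.I) ∂P := by
    intro X hX
    rw [charFun_apply_real, integral_map hX (by fun_prop)]
  have hv := (tendsto_integral_sq hf (fun k => (g k).memLp_toFun) hg).comp hns.tendsto_atTop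
  have h1 : Tendsto (fun k => charFun (P.map ((g (ns k)).integral W)) t) atTop
      (𝓝 (charFun (P.map I) t)) := by
    rw [hchar I hI.aemeasurable]
    simp_rw [fun k => hchar _ (hlaw (ns k)).aemeasurable]
    refine tendsto_integral_of_dominated_convergence (fun _ => 1) (fun k => ?_)
      (integrable_const _) (fun k => ae_of_all _ fun ω => ?_) ?_
    · have := (hlaw (ns k)).aemeasurable
      exact AEMeasurable.aestronglyMeasurable (by fun_prop)
    · rw [← Complex.ofReal_mul, Complex.norm_exp_ofReal_mul_I]
    · filter_upwards [hae] with ω hω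
      have hcont : Continuous fun x : ℝ => Complex.exp (t * x * Complex.I) := by fun_prop
      exact (hcont.tendsto _).comp hω
  refine tendsto_nhds_unique h1 ?_
  simp_rw [fun k => (hlaw (ns k)).map_eq, charFun_gaussianReal]
  have h0 : ∀ k : ℝ → ℝ, 0 ≤ ∫ x, k x ^ 2 := fun k => integral_nonneg fun x => sq_nonneg _
  simp_rw [Real.coe_toNNReal _ (h0 _)]
  have hcont : Continuous fun v : ℝ =>
      Complex.exp (t * (0 : ℝ) * Complex.I - v * t ^ 2 / 2) := by fun_prop
  exact (hcont.tendsto _).comp hv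

lemma IsWienerIntegral.sum (hW : IsTwoSidedBrownian W P) {κ : Type*} [Fintype κ] (a : κ → ℝ)
    {f : κ → ℝ → ℝ} {I : κ → Ω → ℝ} (h : ∀ k, IsWienerIntegral W P (f k) (I k)) :
    IsWienerIntegral W P (fun x => ∑ k, a k * f k x) (fun ω => ∑ k, a k * I k ω) := by
  choose hf hI g hg hgI using h
  refine ⟨memLp_finsetSum _ fun k _ => (hf k).const_mul _,
    memLp_finsetSum _ fun k _ => (hI k).const_mul _,
    fun j => StepFunction.linComb a fun k => g k j, ?_, ?_⟩
  · have hb : ∀ j, eLpNorm (fun x => ∑ k, a k * f k x -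
        (StepFunction.linComb a fun k => g k j).toFun x) 2 volume ≤
        ∑ k, ‖a k‖ₑ * eLpNorm (fun x => f k x - (g k j).toFun x) 2 volume := by
      intro j
      have e : (fun x => ∑ k, a k * f k x - (StepFunction.linComb a fun k => g k j).toFun x) =
          ∑ k, a k • fun x => f k x - (g k j).toFun x := by
        ext x
        simp [StepFunction.toFun_linComb, ← Finset.sum_sub_distrib, mul_sub]
      rw [e]
      refine (eLpNorm_sum_le (fun k _ => (((hf k).sub (g k j).memLp_toFun).const_smul
        (a k)).aestronglyMeasurable) (by norm_num)).trans (Finset.sum_le_sum fun k _ => ?_)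
      rw [eLpNorm_const_smul]
      exact le_rfl
    refine tendsto_of_tendsto_of_tendsto_of_le_of_le tendsto_const_nhds ?_
      (fun _ => zero_le) hb
    have : Tendsto (fun j => ∑ k, ‖a k‖ₑ * eLpNorm (fun x => f k x - (g k j).toFun x) 2 volume)
        atTop (𝓝 (∑ k, ‖a k‖ₑ * 0)) :=
      tendsto_finsetSum _ fun k _ => ENNReal.Tendsto.const_mul (hg k) (Or.inr (by simp))
    simpa using this
  · have hlaw := fun k j => hW.hasLaw_integral (g k j)
    have hb : ∀ j, eLpNorm (fun ω => ∑ k, a k * I k ω -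
        (StepFunction.linComb a fun k => g k j).integral W ω) 2 P ≤
        ∑ k, ‖a k‖ₑ * eLpNorm (fun ω => I k ω - (g k j).integral W ω) 2 P := by
      intro j
      have e : (fun ω => ∑ k, a k * I k ω - (StepFunction.linComb a fun k => g k j).integral W ω) =
          ∑ k, a k • fun ω => I k ω - (g k j).integral W ω := by
        ext x
        simp [StepFunction.integral_linComb, ← Finset.sum_sub_distrib, mul_sub]
      rw [e]
      refine (eLpNorm_sum_le (fun k _ => (((hI k).sub (memLp_of_hasLaw_gaussianReal
        (hlaw k j))).const_smul
        (a k)).aestronglyMeasurable) (by norm_num)).trans (Finset.sum_le_sum fun k _ => ?_)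
      rw [eLpNorm_const_smul]
      exact le_rfl
    refine tendsto_of_tendsto_of_tendsto_of_le_of_le tendsto_const_nhds ?_
      (fun _ => zero_le) hb
    have : Tendsto (fun j => ∑ k, ‖a k‖ₑ * eLpNorm (fun ω => I k ω - (g k j).integral W ω) 2 P)
        atTop (𝓝 (∑ k, ‖a k‖ₑ * 0)) :=
      tendsto_finsetSum _ fun k _ => ENNReal.Tendsto.const_mul (hgI k) (Or.inr (by simp))
    simpa using this

/-- An almost sure limit of elementary integrals is a Wiener integral if the step functions
converge in `L²`. -/
lemma IsWienerIntegral.of_ae_tendsto (hW : IsTwoSidedBrownian W P) {f : ℝ → ℝ} {I : Ω → ℝ}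
    (hf : MemLp f 2 volume) {g : ℕ → StepFunction}
    (hg : Tendsto (fun k => eLpNorm (fun x => f x - (g k).toFun x) 2 volume) atTop (𝓝 0))
    (hI : ∀ᵐ ω ∂P, Tendsto (fun k => (g k).integral W ω) atTop (𝓝 (I ω))) :
    IsWienerIntegral W P f I := by
  have hlaw := fun k => hW.hasLaw_integral (g k)
  have hImeas : AEStronglyMeasurable I P := aestronglyMeasurable_of_tendsto_ae atTop
    (fun k => (hlaw k).aemeasurable.aestronglyMeasurable) hI
  have hle : ∀ k, eLpNorm (fun ω => I ω - (g k).integral W ω) 2 P ≤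
      eLpNorm (fun x => f x - (g k).toFun x) 2 volume := by
    intro k
    -- Fatou in j with k fixed: the isometry and the triangle inequality bound the j-th norm by the
    -- L² errors of both step functions, and the j-th error disappears in the limit.
    have h1 := Lp.eLpNorm_lim_le_liminf_eLpNorm (p := 2) (μ := P)
      (f := fun j ω => (g j).integral W ω - (g k).integral W ω)
      (fun j => ((hlaw j).aemeasurable.sub (hlaw k).aemeasurable).aestronglyMeasurable)
      (fun ω => I ω - (g k).integral W ω) (by
        filter_upwards [hI] with ω hω using hω.sub_const _)
    refine h1.trans ?_
    have h2 : ∀ j, eLpNorm (fun ω => (g j).integral W ω - (g k).integral W ω) 2 P ≤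
        eLpNorm (fun x => f x - (g j).toFun x) 2 volume +
          eLpNorm (fun x => f x - (g k).toFun x) 2 volume := by
      intro j
      rw [hW.eLpNorm_integral_sub]
      have e : (fun x => (g j).toFun x - (g k).toFun x) =
          (fun x => f x - (g k).toFun x) - fun x => f x - (g j).toFun x := by
        ext x; simp
      rw [e, add_comm]
      exact eLpNorm_sub_le (hf.sub (g k).memLp_toFun).aestronglyMeasurable
        (hf.sub (g j).memLp_toFun).aestronglyMeasurable (by norm_num)
    have h3 := hg.add_const (eLpNorm (fun x => f x - (g k).toFun x) 2 volume)
    rw [zero_add] at h3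
    rw [← h3.liminf_eq]
    exact liminf_le_liminf (Eventually.of_forall h2)
  have hmem0 : MemLp (fun ω => I ω - (g 0).integral W ω) 2 P :=
    ⟨hImeas.sub (hlaw 0).aemeasurable.aestronglyMeasurable,
      (hle 0).trans_lt (hf.sub (g 0).memLp_toFun).eLpNorm_lt_top⟩
  have hmem : MemLp I 2 P := by
    have := hmem0.add (memLp_of_hasLaw_gaussianReal (hlaw 0))
    refine this.ae_eq (ae_of_all _ fun ω => ?_)
    simp
  exact ⟨hf, hmem, g, hg, tendsto_of_tendsto_of_tendsto_of_le_of_le tendsto_const_nhds hg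
    (fun _ => zero_le) hle⟩

lemma IsWienerIntegral.integral_eq_zero (hW : IsTwoSidedBrownian W P) {f : ℝ → ℝ} {I : Ω → ℝ}
    (h : IsWienerIntegral W P f I) : ∫ ω, I ω ∂P = 0 :=
  integral_of_hasLaw_gaussianReal (h.hasLaw hW)

lemma IsWienerIntegral.integral_sq (hW : IsTwoSidedBrownian W P) {f : ℝ → ℝ} {I : Ω → ℝ}
    (h : IsWienerIntegral W P f I) : ∫ ω, I ω ^ 2 ∂P = ∫ x, f x ^ 2 := by
  rw [integral_sq_of_hasLaw_gaussianReal (h.hasLaw hW),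
    Real.coe_toNNReal _ (integral_nonneg fun x => sq_nonneg _)]

/-- The isometry for Wiener integrals. -/
lemma IsWienerIntegral.integral_mul (hW : IsTwoSidedBrownian W P) {f f' : ℝ → ℝ} {I I' : Ω → ℝ}
    (h : IsWienerIntegral W P f I) (h' : IsWienerIntegral W P f' I') :
    ∫ ω, I ω * I' ω ∂P = ∫ x, f x * f' x := by
  -- Polarization: the isometry for the sum, minus those for the summands, leaves the cross term.
  have hs := IsWienerIntegral.sum hW ![1, 1] (f := ![f, f']) (I := ![I, I'])
    (by intro k; fin_cases k <;> assumption)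
  have e := hs.integral_sq hW
  simp only [Fin.sum_univ_two, Matrix.cons_val_zero, Matrix.cons_val_one, one_mul] at e
  rw [integral_add_sq h.1 h'.1, integral_add_sq h.2.1 h'.2.1, h.integral_sq hW,
    h'.integral_sq hW] at e
  linarith

end wiener

/-! ### Kernels and their grid approximations -/

lemma tendsto_eLpNorm_two_of_dominated {f b : ℝ → ℝ} {g : ℕ → ℝ → ℝ} (hf : MemLp f 2 volume)
    (hg : ∀ k, MemLp (g k) 2 volume) (hb : MemLp b 2 volume)
    (hle : ∀ k x, |f x - g k x| ≤ b x) (hlim : ∀ x, Tendsto (fun k => g k x) atTop (𝓝 (f x))) :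
    Tendsto (fun k => eLpNorm (fun x => f x - g k x) 2 volume) atTop (𝓝 0) := by
  have hm : ∀ k, MemLp (fun x => f x - g k x) 2 volume := fun k => hf.sub (hg k)
  have h1 : Tendsto (fun k => ∫ x, (f x - g k x) ^ 2) atTop (𝓝 (∫ _ : ℝ, (0 : ℝ))) := by
    refine tendsto_integral_of_dominated_convergence (fun x => b x ^ 2)
      (fun k => (hm k).integrable_sq.aestronglyMeasurable) hb.integrable_sq
      (fun k => ae_of_all _ fun x => ?_) (ae_of_all _ fun x => ?_)
    · rw [Real.norm_eq_abs, abs_pow]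
      exact pow_le_pow_left₀ (abs_nonneg _) (hle k x) 2
    · have := ((hlim x).const_sub (f x)).pow 2
      simpa using this
  rw [integral_zero] at h1
  have h2 := h1.sqrt
  rw [Real.sqrt_zero] at h2
  rw [← ENNReal.tendsto_toReal_iff (fun k => (hm k).eLpNorm_ne_top) ENNReal.zero_ne_top]
  refine h2.congr fun k => ?_
  rw [← toReal_eLpNorm_two_sq (hm k), Real.sqrt_sq ENNReal.toReal_nonneg]

/-- The step function whose elementary integral is `riemannSum`. -/
noncomputable def gridStep (m : ℕ) (t : ℝ) (M : ℕ) : StepFunction where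
  size := M * M
  c i := green m ((i : ℕ) / M)
  l i := t - ((i : ℕ) + 1) / M
  r i := t - (i : ℕ) / M
  l_le_r i := by gcongr; linarith

lemma integral_gridStep {Ω : Type*} (W : ℝ → Ω → ℝ) (m : ℕ) (t : ℝ) (M : ℕ) (ω : Ω) :
    (gridStep m t M).integral W ω = riemannSum (fun s => W s ω) m t M := by
  rw [riemannSum, Finset.sum_range]
  rfl

/-- The cells are open on the left in s, hence closed on the left in u = t - s, so ⌊Mu⌋ selects the
unique active cell. -/
lemma toFun_gridStep (m : ℕ) (t : ℝ) {M : ℕ} (hM : 0 < M) (s : ℝ) :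
    (gridStep m t M).toFun s = if s ≤ t ∧ ⌊M * (t - s)⌋₊ < M * M then
      green m (⌊M * (t - s)⌋₊ / M) else 0 := by
  have hM' : (0 : ℝ) < M := by exact_mod_cast hM
  have hmem : ∀ i : ℕ, s ∈ Set.Ioc (t - ((i : ℝ) + 1) / M) (t - i / M) ↔
      s ≤ t ∧ ⌊M * (t - s)⌋₊ = i := by
    intro i
    have e : s ∈ Set.Ioc (t - ((i : ℝ) + 1) / M) (t - i / M) ↔
        (i : ℝ) ≤ M * (t - s) ∧ M * (t - s) < i + 1 := by
      rw [Set.mem_Ioc, sub_lt_comm, lt_div_iff₀ hM', le_sub_comm, div_le_iff₀ hM', mul_comm, and_comm]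
    rw [e]
    constructor
    · intro h
      have h0 : 0 ≤ (M : ℝ) * (t - s) := (Nat.cast_nonneg i).trans h.1
      exact ⟨sub_nonneg.1 (nonneg_of_mul_nonneg_right h0 hM'), (Nat.floor_eq_iff h0).2 h⟩
    · rintro ⟨h, rfl⟩
      have h0 : 0 ≤ (M : ℝ) * (t - s) := mul_nonneg hM'.le (sub_nonneg.2 h)
      exact ⟨Nat.floor_le h0, Nat.lt_floor_add_one _⟩
  have e1 : (gridStep m t M).toFun s = ∑ i ∈ Finset.range (M * M),
      if s ≤ t ∧ ⌊M * (t - s)⌋₊ = i then green m (i / M) else 0 := by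
    rw [Finset.sum_range]
    refine Finset.sum_congr rfl fun i _ => ?_
    change (Set.Ioc (t - (((i : ℕ) : ℝ) + 1) / M) (t - (i : ℕ) / M)).indicator _ s = _
    rw [Set.indicator_apply]
    simp only [hmem]
    rfl
  rw [e1]
  by_cases hs : s ≤ t
  · simp [hs]
  · simp [hs]

/-- An exponential bound for the kernels and their approximations. -/
noncomputable def expBound (B t : ℝ) : ℝ → ℝ := (Set.Iic t).indicator fun s => B * Real.exp (s - t)

lemma memLp_expBound (B t : ℝ) : MemLp (expBound B t) 2 volume := by
  have hm : Measurable (expBound B t) := Measurable.indicator (by fun_prop) measurableSet_Iic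
  rw [memLp_two_iff_integrable_sq hm.aestronglyMeasurable]
  have e : (fun s => expBound B t s ^ 2) =
      (Set.Iic t).indicator fun s => (B ^ 2 * Real.exp (-2 * t)) * Real.exp (2 * s) := by
    ext s
    simp only [expBound, Set.indicator]
    split_ifs
    · rw [mul_pow, ← Real.exp_nat_mul, mul_assoc, ← Real.exp_add]
      push_cast
      ring_nf
    · simp
  rw [e, integrable_indicator_iff measurableSet_Iic]
  exact (integrableOn_exp_mul_Iic two_pos t).const_mul _

lemma kernel_eq (n : ℕ+) (t : ℝ) :
    kernel n t = (Set.Iic t).indicator fun s => green ((n : ℕ) - 1) (t - s) := rfl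

lemma measurable_kernel (n : ℕ+) (t : ℝ) : Measurable (kernel n t) := by
  rw [kernel_eq]
  exact Measurable.indicator (by have := continuous_green ((n : ℕ) - 1); fun_prop) measurableSet_Iic

lemma abs_kernel_le (n : ℕ+) (t s : ℝ) : |kernel n t s| ≤ expBound 2 t s := by
  rw [kernel_eq, expBound]
  by_cases hs : s ≤ t
  · rw [Set.indicator_of_mem (show s ∈ Set.Iic t from hs),
      Set.indicator_of_mem (show s ∈ Set.Iic t from hs)]
    have := abs_green_le ((n : ℕ) - 1) (t - s)
    rwa [abs_of_nonneg (sub_nonneg.2 hs), neg_sub] at this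
  · rw [Set.indicator_of_notMem (by simpa using hs), Set.indicator_of_notMem (by simpa using hs),
      abs_zero]

lemma memLp_kernel (n : ℕ+) (t : ℝ) : MemLp (kernel n t) 2 volume :=
  (memLp_expBound 2 t).mono' (measurable_kernel n t).aestronglyMeasurable
    (ae_of_all _ (abs_kernel_le n t))

lemma abs_gridStep_le (m : ℕ) (t : ℝ) {M : ℕ} (hM : 0 < M) (s : ℝ) :
    |(gridStep m t M).toFun s| ≤ expBound (2 * Real.exp 1) t s := by
  rw [toFun_gridStep m t hM, expBound]
  have hM' : (1 : ℝ) ≤ M := by exact_mod_cast hM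
  by_cases hs : s ≤ t
  · rw [Set.indicator_of_mem (show s ∈ Set.Iic t from hs)]
    split_ifs
    · refine (abs_green_le _ _).trans ?_
      rw [abs_of_nonneg (by positivity), mul_assoc, ← Real.exp_add]
      -- Rounding down moves the argument by at most 1/M ≤ 1, which explains the factor exp 1 in the
      -- bound.
      have h1 : (M : ℝ) * (t - s) - 1 ≤ ⌊M * (t - s)⌋₊ := (Nat.sub_one_lt_floor _).le
      have h2 : t - s - 1 ≤ ⌊M * (t - s)⌋₊ / M := by
        rw [le_div_iff₀ (by linarith)]
        nlinarith
      gcongr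
      linarith
    · rw [abs_zero]; positivity
  · rw [Set.indicator_of_notMem (by simpa using hs), if_neg (by tauto), abs_zero]

lemma tendsto_gridStep (n : ℕ+) (t s : ℝ) :
    Tendsto (fun M : ℕ => (gridStep ((n : ℕ) - 1) t (M + 1)).toFun s) atTop
      (𝓝 (kernel n t s)) := by
  rw [tendsto_add_atTop_iff_nat (f := fun M => (gridStep ((n : ℕ) - 1) t M).toFun s) 1, kernel_eq]
  by_cases hs : s ≤ t
  · rw [Set.indicator_of_mem (show s ∈ Set.Iic t from hs)]
    have h0 := sub_nonneg.2 hs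
    have h1 : Tendsto (fun M : ℕ => (⌊(M : ℝ) * (t - s)⌋₊ : ℝ) / M) atTop (𝓝 (t - s)) := by
      have := (tendsto_nat_floor_mul_div_atTop h0).comp (tendsto_natCast_atTop_atTop (R := ℝ))
      refine this.congr fun M => ?_
      simp [mul_comm]
    refine (((continuous_green ((n : ℕ) - 1)).tendsto _).comp h1).congr' ?_
    filter_upwards [(tendsto_natCast_atTop_atTop (R := ℝ)).eventually_gt_atTop (t - s),
      eventually_gt_atTop 0] with M hM hM0
    have hM' : (0 : ℝ) < M := by exact_mod_cast hM0
    have hlt : ⌊(M : ℝ) * (t - s)⌋₊ < M * M := by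
      rw [Nat.floor_lt (by positivity)]
      push_cast
      gcongr
    rw [toFun_gridStep _ _ hM0, if_pos ⟨hs, hlt⟩]
    rfl
  · rw [Set.indicator_of_notMem (by simpa using hs)]
    refine tendsto_const_nhds.congr' ?_
    filter_upwards [eventually_gt_atTop 0] with M hM0
    rw [toFun_gridStep _ _ hM0, if_neg (by tauto)]

lemma isWienerIntegral_pathIntegral {Ω : Type*} [MeasurableSpace Ω] {P : Measure Ω}
    {W : ℝ → Ω → ℝ} (hW : IsTwoSidedBrownian W P) (n : ℕ+) (t : ℝ) :
    IsWienerIntegral W P (kernel n t)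
      (fun ω => pathIntegral (fun s => W s ω) ((n : ℕ) - 1) t) := by
  have := hW.isGaussianProcess.isProbabilityMeasure
  refine IsWienerIntegral.of_ae_tendsto hW (memLp_kernel n t)
    (g := fun M => gridStep ((n : ℕ) - 1) t (M + 1)) ?_ ?_
  · refine tendsto_eLpNorm_two_of_dominated (memLp_kernel n t) (fun k => StepFunction.memLp_toFun _)
      ((memLp_expBound 2 t).add (memLp_expBound (2 * Real.exp 1) t)) (fun k x => ?_)
      (tendsto_gridStep n t)
    exact (abs_sub _ _).trans (add_le_add (abs_kernel_le n t x)
      (abs_gridStep_le _ t k.succ_pos x))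
  · filter_upwards [hW.ae_continuous, hW.ae_abs_le] with ω hc hC
    obtain ⟨C, hC⟩ := hC
    simp_rw [integral_gridStep]
    exact tendsto_riemannSum hc hC _ t

/-- Since 1/cosh² = tanh', the product of two kernels is the exact derivative of -tanh^{n+m-1}(t -
s)/(n+m-1), which vanishes at s = t and tends to -1/(n+m-1) as s → -∞. -/
lemma integral_kernel_mul_kernel (n m : ℕ+) (t : ℝ) :
    ∫ s, kernel n t s * kernel m t s = 1 / ((n : ℝ) + (m : ℝ) - 1) := by
  obtain ⟨a, rfl⟩ : ∃ a : ℕ, n = a.succPNat := ⟨n.natPred, by simp⟩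
  obtain ⟨b, rfl⟩ : ∃ b : ℕ, m = b.succPNat := ⟨m.natPred, by simp⟩
  have hint := (memLp_kernel a.succPNat t).integrable_mul (memLp_kernel b.succPNat t)
  set k : ℝ → ℝ := fun s => Real.tanh (t - s) ^ (a + b) * (1 - Real.tanh (t - s) ^ 2) with hk
  have e : (fun s => kernel a.succPNat t s * kernel b.succPNat t s) = (Set.Iic t).indicator k := by
    ext s
    simp only [kernel, Set.indicator, Nat.succPNat_coe, Nat.succ_eq_add_one, Nat.add_sub_cancel, hk]
    split_ifs
    · have h1 := (Real.cosh_pos (t - s)).ne'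
      have h2 := Real.cosh_sq (t - s)
      have h3 : 1 - Real.tanh (t - s) ^ 2 = 1 / Real.cosh (t - s) ^ 2 := by
        rw [Real.tanh_eq_sinh_div_cosh]
        field_simp
        linarith
      rw [h3, pow_add]
      field_simp
    · simp
  have hint' : IntegrableOn k (Set.Iic t) := by
    rw [← integrable_indicator_iff measurableSet_Iic, ← e]
    exact hint
  have hd : ∀ s ∈ Set.Iic t, HasDerivAt
      (fun s => -Real.tanh (t - s) ^ (a + b + 1) / ((a + b + 1 : ℕ) : ℝ)) (k s) s := by
    intro s _
    have h1 := ((hasDerivAt_real_tanh (t - s)).comp_const_sub t s).pow (a + b + 1)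
    have h2 := (h1.neg).div_const ((a + b + 1 : ℕ) : ℝ)
    refine h2.congr_deriv ?_
    have : ((a + b + 1 : ℕ) : ℝ) ≠ 0 := by positivity
    simp only [hk, Nat.add_sub_cancel]
    field_simp
  have hlim : Tendsto (fun s => -Real.tanh (t - s) ^ (a + b + 1) / ((a + b + 1 : ℕ) : ℝ)) atBot
      (𝓝 (-1 ^ (a + b + 1) / ((a + b + 1 : ℕ) : ℝ))) := by
    refine Tendsto.div_const (Tendsto.neg (Tendsto.pow ?_ _)) _
    exact tendsto_real_tanh_atTop.comp (tendsto_atTop_add_const_left atBot t tendsto_neg_atBot_atTop)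
  rw [e, integral_indicator measurableSet_Iic,
    integral_Iic_of_hasDerivAt_of_tendsto' hd hint' hlim]
  simp
  ring

lemma kernel_add (n : ℕ+) (t h x : ℝ) : kernel n (t + h) x = kernel n t (x - h) := by
  simp only [kernel, Set.indicator, Set.mem_Iic, sub_le_iff_le_add]
  rw [show t + h - x = t - (x - h) by ring]

/-! ### Joint laws of Wiener integrals -/

section field

variable {Ω : Type*} [MeasurableSpace Ω] {P : Measure Ω} {W : ℝ → Ω → ℝ}

lemma IsWienerIntegral.hasLaw_dual (hW : IsTwoSidedBrownian W P) {κ : Type*} [Fintype κ]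
    {f : κ → ℝ → ℝ} {I : κ → Ω → ℝ} (h : ∀ k, IsWienerIntegral W P (f k) (I k))
    (L : StrongDual ℝ (κ → ℝ)) :
    HasLaw (fun ω => L fun k => I k ω)
      (gaussianReal 0 (∫ x, L (fun k => f k x) ^ 2).toNNReal) P := by
  classical
  have hL : ∀ x : κ → ℝ, L x = ∑ k, L (Pi.single k 1) * x k := fun x => by
    conv_lhs => rw [pi_eq_sum_univ' x, map_sum]
    refine Finset.sum_congr rfl fun k _ => ?_
    rw [map_smul, smul_eq_mul, mul_comm]
  convert! (IsWienerIntegral.sum hW (fun k => L (Pi.single k 1)) h).hasLaw hW using 1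
  · exact funext fun ω => hL _
  · simp_rw [← hL]

lemma IsWienerIntegral.aemeasurable_pi {κ : Type*} [Fintype κ]
    {f : κ → ℝ → ℝ} {I : κ → Ω → ℝ} (h : ∀ k, IsWienerIntegral W P (f k) (I k)) :
    AEMeasurable (fun ω k => I k ω) P :=
  aemeasurable_pi_lambda _ fun k => (h k).2.1.aemeasurable

lemma IsWienerIntegral.map_dual (hW : IsTwoSidedBrownian W P) {κ : Type*} [Fintype κ]
    {f : κ → ℝ → ℝ} {I : κ → Ω → ℝ} (h : ∀ k, IsWienerIntegral W P (f k) (I k))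
    (L : StrongDual ℝ (κ → ℝ)) :
    (P.map fun ω k => I k ω).map L = gaussianReal 0 (∫ x, L (fun k => f k x) ^ 2).toNNReal := by
  rw [AEMeasurable.map_map_of_aemeasurable (by fun_prop) (IsWienerIntegral.aemeasurable_pi h)]
  exact (IsWienerIntegral.hasLaw_dual hW h L).map_eq

/-- Wiener integrals are jointly Gaussian. -/
lemma isGaussianProcess_of_isWienerIntegral (hW : IsTwoSidedBrownian W P) {κ : Type*}
    {f : κ → ℝ → ℝ} {I : κ → Ω → ℝ} (h : ∀ k, IsWienerIntegral W P (f k) (I k)) :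
    IsGaussianProcess I P :=
  ⟨fun J => ⟨isGaussian_of_map_eq_gaussianReal fun L =>
    ⟨0, _, IsWienerIntegral.map_dual hW (fun k : J => h k) L⟩⟩⟩

/-- The joint law of Wiener integrals does not change when all integrands are translated. -/
lemma IsWienerIntegral.identDistrib_of_translate (hW : IsTwoSidedBrownian W P) {κ : Type*}
    [Fintype κ] {f : κ → ℝ → ℝ} {I I' : κ → Ω → ℝ} (s : ℝ)
    (h : ∀ k, IsWienerIntegral W P (fun x => f k (x - s)) (I k))
    (h' : ∀ k, IsWienerIntegral W P (f k) (I' k)) :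
    IdentDistrib (fun ω k => I k ω) (fun ω k => I' k ω) P P := by
  have := hW.isGaussianProcess.isProbabilityMeasure
  -- By Cramér–Wold it suffices to compare linear functionals. Each is centred Gaussian with
  -- variance the integral of the squared combined integrand, which translation does not change.
  refine ⟨aemeasurable_pi h, aemeasurable_pi h', Measure.ext_of_charFunDual ?_⟩
  ext L
  rw [charFunDual_eq_charFun_map_one, charFunDual_eq_charFun_map_one, map_dual hW h,
    map_dual hW h', integral_sub_right_eq_self (fun x => L (fun k => f k x) ^ 2) s]

end field

end ShellModel

theorem mainTheorem8 {Ω : Type*} [MeasurableSpace Ω] (P : Measure Ω) [IsProbabilityMeasure P]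
    (W : ℝ → Ω → ℝ) (hW : ShellModel.IsTwoSidedBrownian W P) :
    -- almost surely, the system started at any time `-T` from any admissible datum has a solution,
    -- and only one
    (∀ᵐ ω ∂P, ∀ (T : ℝ) (α : ℕ+ → ℝ), ShellModel.IsAdmissible α →
      ∃ a : ℕ → ℝ → ℝ, ShellModel.IsForcedSolution (fun s => W s ω) (-T) α a ∧
        ∀ b : ℕ → ℝ → ℝ, ShellModel.IsForcedSolution (fun s => W s ω) (-T) α b →
          ∀ n t, -T ≤ t → b n t = a n t) ∧
    ∃ A : ℕ+ → ℝ → Ω → ℝ,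
      -- `A n t` is the stochastic integral over `(-∞, t]` of `tanh^{n-1}(t-s) / cosh(t-s)`
      (∀ n t, ShellModel.IsWienerIntegral W P (ShellModel.kernel n t) (A n t)) ∧
      -- convergence as the starting time `-T` goes to `-∞`
      (∀ (n : ℕ+) (t : ℝ), ∀ᵐ ω ∂P, ∀ α : ℕ+ → ℝ, ShellModel.IsAdmissible α →
        ∀ a : ℝ → ℕ → ℝ → ℝ,
          (∀ T : ℝ, ShellModel.IsForcedSolution (fun s => W s ω) (-T) α (a T)) →
            Tendsto (fun T : ℝ => a T n t) atTop (𝓝 (A n t ω))) ∧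
      -- the limit is a Gaussian process, jointly in `n` and `t`, with mean zero
      IsGaussianProcess (fun (p : ℕ+ × ℝ) ω => A p.1 p.2 ω) P ∧
      (∀ n t, ∫ ω, A n t ω ∂P = 0) ∧
      -- it is stationary
      (∀ (h : ℝ) (J : Finset (ℕ+ × ℝ)),
        IdentDistrib (fun ω (p : J) => A p.1.1 (p.1.2 + h) ω)
          (fun ω (p : J) => A p.1.1 p.1.2 ω) P P) ∧
      -- its covariance
      (∀ (n m : ℕ+) (t : ℝ), ∫ ω, A n t ω * A m t ω ∂P = 1 / ((n : ℝ) + (m : ℝ) - 1)) := by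
  have hI := fun n t => ShellModel.isWienerIntegral_pathIntegral hW n t
  refine ⟨?_, fun n t ω => ShellModel.pathIntegral (fun s => W s ω) ((n : ℕ) - 1) t, hI, ?_,
    ShellModel.isGaussianProcess_of_isWienerIntegral hW fun p : ℕ+ × ℝ => hI p.1 p.2,
    fun n t => (hI n t).integral_eq_zero hW, fun h J => ?_, fun n m t => ?_⟩
  · filter_upwards [hW.ae_continuous] with ω hω T α hα
    obtain ⟨a, -, ha⟩ := hα.exists_solution
    exact ⟨_, ha _ hω (-T), fun b hb n t ht => (ha _ hω (-T)).unique hb n ht⟩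
  · intro n t
    filter_upwards [hW.ae_continuous, hW.ae_abs_le] with ω hω ⟨C, hC⟩ α hα a ha
    obtain ⟨b, hb0, hb⟩ := hα.exists_solution
    have hn : (n : ℕ) = (n : ℕ) - 1 + 1 := (Nat.succ_pred_eq_of_pos n.pos).symm
    have hb0' := (hb0 n).comp (tendsto_atTop_add_const_left atTop t tendsto_id)
    have hlim := hb0'.add (ShellModel.tendsto_forced hω hC ((n : ℕ) - 1) t)
    rw [zero_add] at hlim
    refine hlim.congr' ?_
    -- Uniqueness identifies the given solution with the explicit one only once t lies after the
    -- starting time -T.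
    filter_upwards [eventually_ge_atTop (-t)] with T hT
    rw [((hb _ hω (-T)).unique (ha T) n (by linarith)), ← hn, sub_neg_eq_add]
    rfl
  · refine ShellModel.IsWienerIntegral.identDistrib_of_translate hW h
      (f := fun p : J => ShellModel.kernel p.1.1 p.1.2) (fun p => ?_) fun p => hI _ _
    convert! hI p.1.1 (p.1.2 + h) using 1
    exact funext fun x => (ShellModel.kernel_add _ _ _ x).symm
  · rw [(hI n t).integral_mul hW (hI m t), ShellModel.integral_kernel_mul_kernel]
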